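/- Notation. For $u\in H^{1/2}(\mathbb R)=W^{1/2,2}(\mathbb R)$, i.e. $u\in L^2(\mathbb R)$ real-valued with $\int_{\mathbb R}\int_{\mathbb R}\frac{|u(x)-u(y)|^2}{|x-y|^2}\,dx\,dy<\infty$, let $(-\Delta)^{1/4}u=\mathscr F^{-1}(|\xi|^{1/2}\mathscr F u)\in L^2(\mathbb R)$, where $\mathscr F$ is the Fourier transform with kernel $e^{-ix\xi}$. Let $I=(a,b)$, $a<b$, be a bounded open interval and let $H_0^{1/2}(I)=W_0^{1/2,2}(I)$ be the space of all $u\in H^{1/2}(\mathbb R)$ that vanish a.e. outside $I$. For a set $D\in\{I,\mathbb R\}$ put $$E=E_D=\{u\in H_0^{1/2}(I):\ \|(-\Delta)^{1/4}u\|_{L^2(D)}\le 1\},$$ $$\Phi(u)=\int_I\int_I\log\frac1{|x-y|}\,G(u(x))G(u(y))\,dx\,dy .$$ Put also $$E_\infty=\{u\in H^{1/2}(\mathbb R):\ \|(-\Delta)^{1/4}u\|_{L^2(\mathbb R)}^2+\|u\|_{L^2(\mathbb R)}^2\le 1\},$$ $$\Psi(u)=\int_{\mathbb R}\int_{\mathbb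 R}\log^+\frac1{|x-y|}\,G(u(x))G(u(y))\,dx\,dy-\int_{\mathbb R}\int_{\mathbb R}\log^+|x-y|\,G(u(x))G(u(y))\,dx\,dy\in[-\infty,\infty),$$ where $\log^+=\max\{\log,0\}$ (the first integral is finite for $u\in H^{1/2}(\mathbb R)$ under the assumptions of (ii)). Assumption (A): $G:\mathbb R\to[0,\infty)$ is even, continuous and strictly increasing on $[0,\infty)$, and there are $\alpha,c>0$ with $G(t)\le c\,e^{\alpha t^2}$ for all $t\in\mathbb R$. Assumption (A$_1$): $G$ satisfies (A) and $G(t)=O(|t|)$ as $t\to0$. **Proposition 1.5.** Suppose that $G\in C^1(\mathbb R)$ satisfies (A), and that $g:=G'$ satisfies $g(t)\le c\,e^{\alpha t^2}$ for all $t\in\mathbb R$, with some constants $c,\alpha>0$. (i) Let $D=I$ or $D=\mathbb R$, and let $u\in E_D$ be a maximizer of $\Phi$ on $E_D$. Then there exists $\theta>0$ such that $$\int_D(-\Delta)^{1/4}u\,(-\Delta)^{1/4}\varphi\,dx=\theta\int_I\Big(\log\frac1{|\cdot|}*(1_IG(u))\Big)g(u)\,\varphi\,dx\qquad\text{for all }\varphi\in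 H_0^{1/2}(I).$$ (ii) If $G$ satisfies (A$_1$) and $u\in E_\infty$ is a maximizer of $\Psi$ on $E_\infty$, then there exists $\theta\in\mathbb R$ such that $$\int_{\mathbb R}\Big((-\Delta)^{1/4}u\,(-\Delta)^{1/4}\varphi+u\varphi\Big)dx=\theta\int_{\mathbb R}\Big(\log\frac1{|\cdot|}*G(u)\Big)g(u)\,\varphi\,dx$$ for all $\varphi\in H^{1/2}(\mathbb R)$ with bounded support. In both equations the convolution integrals converge absolutely almost everywhere (on $I$, respectively on $\mathbb R$), and the integrals on the right-hand sides converge absolutely. -/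

import Mathlib

namespace LogTM

noncomputable section

open MeasureTheory Asymptotics
open scoped FourierTransform ENNReal Topology Real

/-- The class in `L²(ℝ; ℂ)` of a square-integrable function (and `0` if the function is not
square-integrable). -/
def toL2 (f : ℝ → ℂ) : Lp ℂ 2 (volume : Measure ℝ) :=
  open Classical in if h : MemLp f 2 volume then h.toLp f else 0

/-- The fractional Laplacian `(-Δ)^{1/4} u = 𝓕⁻¹ (|ξ|^{1/2} 𝓕 u)` of `u ∈ H^{1/2}(ℝ)`, with the
Fourier transform on `L²`. Mathlib's Fourier transform has the kernel `exp (-2 π i x ξ)`, so that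
the symbol reads `|2 π ξ|^{1/2}`; the result is real-valued for real-valued `u`. -/
def quarterLaplacian (u : ℝ → ℝ) : ℝ → ℝ := fun x =>
  ((𝓕⁻ (toL2 fun ξ => ((|2 * π * ξ| ^ (1 / 2 : ℝ) : ℝ) : ℂ) *
      (𝓕 (toL2 fun y => (u y : ℂ)) : Lp ℂ 2 (volume : Measure ℝ)) ξ) :
    Lp ℂ 2 (volume : Measure ℝ)) x).re

/-- `u ∈ H^{1/2}(ℝ) = W^{1/2,2}(ℝ)`: `u` is in `L²` and has a finite Gagliardo seminorm. -/
def MemHHalf (u : ℝ → ℝ) : Prop :=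
  MemLp u 2 volume ∧
    ∫⁻ x : ℝ, ∫⁻ y : ℝ, ENNReal.ofReal (|u x - u y| ^ 2 / |x - y| ^ 2) < ∞

/-- `u ∈ H₀^{1/2}(I) = W₀^{1/2,2}(I)`, as a space of functions on the line: the functions in
`H^{1/2}(ℝ)` that vanish outside `I`. -/
def MemHHalfZero (I : Set ℝ) (u : ℝ → ℝ) : Prop :=
  MemHHalf u ∧ ∀ᵐ x : ℝ, x ∉ I → u x = 0

/-- `φ` vanishes outside a bounded set. -/
def HasBoundedSupport (φ : ℝ → ℝ) : Prop :=
  ∃ R : ℝ, ∀ᵐ x : ℝ, R < |x| → φ x = 0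

/-- The set `E = {u ∈ H₀^{1/2}(I) : ‖(-Δ)^{1/4} u‖_{L²(D)} ≤ 1}`. -/
def unitSet (I D : Set ℝ) : Set (ℝ → ℝ) :=
  {u | MemHHalfZero I u ∧ eLpNorm (quarterLaplacian u) 2 (volume.restrict D) ≤ 1}

/-- The norm `(‖(-Δ)^{1/4} u‖₂² + ‖u‖₂²)^{1/2}` of `H^{1/2}(ℝ)`. -/
def normHHalf (u : ℝ → ℝ) : ℝ≥0∞ :=
  (eLpNorm (quarterLaplacian u) 2 volume ^ 2 + eLpNorm u 2 volume ^ 2) ^ (1 / 2 : ℝ)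

/-- The set `E_∞`, the closed unit ball of `H^{1/2}(ℝ)`. -/
def unitSetInfty : Set (ℝ → ℝ) :=
  {u | MemHHalf u ∧ normHHalf u ≤ 1}

/-- Assumption (A). -/
structure CondA (G : ℝ → ℝ) : Prop where
  nonneg : ∀ t, 0 ≤ G t
  even : ∀ t, G (-t) = G t
  continuous : Continuous G
  strictMonoOn : StrictMonoOn G (Set.Ici 0)
  growth : ∃ α > 0, ∃ c > 0, ∀ t, G t ≤ c * Real.exp (α * t ^ 2)

/-- Assumption (A₁). -/
structure CondA1 (G : ℝ → ℝ) : Prop extends CondA G where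
  isBigO : G =O[𝓝 0] fun t => |t|

/-- `∫_S ∫_S log⁺ (1/|x-y|) G(u(x)) G(u(y)) dx dy`. -/
def energyPos (S : Set ℝ) (G u : ℝ → ℝ) : ℝ≥0∞ :=
  ∫⁻ x in S, ∫⁻ y in S, ENNReal.ofReal (Real.posLog (1 / |x - y|) * G (u x) * G (u y))

/-- `∫_S ∫_S log⁺ |x-y| G(u(x)) G(u(y)) dx dy`. -/
def energyNeg (S : Set ℝ) (G u : ℝ → ℝ) : ℝ≥0∞ :=
  ∫⁻ x in S, ∫⁻ y in S, ENNReal.ofReal (Real.posLog |x - y| * G (u x) * G (u y))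

/-- `∫_S ∫_S log (1/|x-y|) G(u(x)) G(u(y)) dx dy`, as the difference of the contributions of the
positive and the negative part of the kernel: `Φ` for `S = I` and `Ψ` for `S = ℝ`. The positive
part is finite for the functions considered here, while the negative one may be infinite for
`S = ℝ`; the value is then `-∞`. -/
def energy (S : Set ℝ) (G u : ℝ → ℝ) : EReal :=
  (energyPos S G u : EReal) - (energyNeg S G u : EReal)

/-- The convolution `log (1/|·|) * (1_S G(u))`. -/
def logPotential (S : Set ℝ) (G u : ℝ → ℝ) (x : ℝ) : ℝ :=
  ∫ y in S, Real.log (1 / |x - y|) * G (u y)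

/-- The integral defining `log (1/|·|) * (1_S G(u))` converges absolutely at almost every point
of `S`. -/
def PotentialDefined (S : Set ℝ) (G u : ℝ → ℝ) : Prop :=
  ∀ᵐ x ∂volume.restrict S, IntegrableOn (fun y => Real.log (1 / |x - y|) * G (u y)) S volume

/-- `u` is a weak solution of the Euler–Lagrange equation on `I` with multiplier `θ`: for all
`φ ∈ H₀^{1/2}(I)`,
`∫_D (-Δ)^{1/4}u (-Δ)^{1/4}φ = θ ∫_I (log (1/|·|) * (1_I G(u))) G'(u) φ`,
where the integrals on the right converge absolutely. -/
def WeakSolution (I D : Set ℝ) (G : ℝ → ℝ) (θ : ℝ) (u : ℝ → ℝ) : Prop :=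
  PotentialDefined I G u ∧
  ∀ φ : ℝ → ℝ, MemHHalfZero I φ →
    IntegrableOn (fun x => logPotential I G u x * deriv G (u x) * φ x) I volume ∧
    ∫ x in D, quarterLaplacian u x * quarterLaplacian φ x =
      θ * ∫ x in I, logPotential I G u x * deriv G (u x) * φ x

/-- `u` is a weak solution of the Euler–Lagrange equation on `ℝ` with multiplier `θ`: for all
`φ ∈ H^{1/2}(ℝ)` with bounded support,
`∫ ((-Δ)^{1/4}u (-Δ)^{1/4}φ + u φ) = θ ∫ (log (1/|·|) * G(u)) G'(u) φ`,
where the integrals on the right converge absolutely. -/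
def WeakSolutionInfty (G : ℝ → ℝ) (θ : ℝ) (u : ℝ → ℝ) : Prop :=
  PotentialDefined Set.univ G u ∧
  ∀ φ : ℝ → ℝ, MemHHalf φ → HasBoundedSupport φ →
    Integrable (fun x => logPotential Set.univ G u x * deriv G (u x) * φ x) volume ∧
    ∫ x, (quarterLaplacian u x * quarterLaplacian φ x + u x * φ x) =
      θ * ∫ x, logPotential Set.univ G u x * deriv G (u x) * φ x

end

end LogTM

/-!
Every `u ∈ H^{1/2}(ℝ)` has `exp (β u²)` integrable on sets of finite measure, for every `β`. Indeed,
cut the Fourier transform at the frequency `R = exp (K t²)`. The low frequencies contribute at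
most `t / 2` pointwise once `t` is large, because the `H^{1/2}` energy beyond a fixed frequency is
small, and the high frequencies have squared `L²` norm `O(1 / R)`; so `|{|u| > t}|` is
`O(exp (-K t²))`. Together with `G' (t) ≤ c exp (α t²)` this makes the energy differentiable along
the curves `u + t φ + t² ψ`, with derivative `2 L φ` at `t = 0`, where
`L φ = ∫ (log (1 / |·|) * G (u)) G' (u) φ`.

Let `B` be the symmetric form defining the constraint `B u u ≤ 1` and let `q = B u`. If `q φ < 0`,
a multiple of `φ` as second-order term keeps the curve admissible, so that `L φ ≤ 0` by maximality.
If `q` and `L` are both nonzero, this forces `q = θ L` with `θ > 0`. If `q = 0`, the constraint is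
inactive when `u` is itself a test function, so that `L = 0` as well; on the whole line, `θ = 0`
will do.

It remains to exclude `L = 0 ≠ q`. In that case the potential vanishes almost everywhere on
`{G' (u) ≠ 0}`, a set that is not null: `G'` vanishes on no interval, while an `H^{1/2}` function
whose values avoid a dense open set would be `0`. A variation `φ` supported where `G' (u) ≠ 0`, in
an interval shorter than `1`, then has no effect through the potential, but
`∬ log (1 / |x - y|) G' (u) φ(x) G' (u) φ(y) > 0`, so the energy increases to second order, while
a direction with `q < 0` keeps the curve admissible.
-/

namespace LogTM

noncomputable section

open MeasureTheory Asymptotics Filter Set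
open scoped FourierTransform ENNReal Topology Real NNReal

/-! ### The space `H^{1/2}(ℝ)` -/

theorem eLpNorm_two_sq {α E : Type*} [MeasurableSpace α] [NormedAddCommGroup E] (μ : Measure α)
    (f : α → E) : eLpNorm f 2 μ ^ 2 = ∫⁻ x, ‖f x‖ₑ ^ 2 ∂μ := by
  simpa using eLpNorm_nnreal_pow_eq_lintegral (μ := μ) (f := f) (p := 2) two_ne_zero

theorem memLp_two_iff {α E : Type*} [MeasurableSpace α] [NormedAddCommGroup E] {μ : Measure α}
    {f : α → E} (hf : AEStronglyMeasurable f μ) : MemLp f 2 μ ↔ ∫⁻ x, ‖f x‖ₑ ^ 2 ∂μ < ∞ := by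
  rw [← eLpNorm_two_sq, ENNReal.pow_lt_top_iff, MemLp]
  simp [hf]

/-- The difference quotient of `u` as a function on the plane. Its `L²` norm is the Gagliardo
seminorm of `W^{1/2,2}(ℝ)`; on the diagonal, a null set, it is `0`. -/
def diffQuotient (u : ℝ → ℝ) (p : ℝ × ℝ) : ℝ := (u p.1 - u p.2) / (p.1 - p.2)

theorem aestronglyMeasurable_diffQuotient {u : ℝ → ℝ} (hu : AEStronglyMeasurable u volume) :
    AEStronglyMeasurable (diffQuotient u) volume :=
  ((hu.comp_fst.sub hu.comp_snd).aemeasurable.div (by fun_prop)).aestronglyMeasurable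

theorem enorm_diffQuotient_sq (u : ℝ → ℝ) (p : ℝ × ℝ) :
    ‖diffQuotient u p‖ₑ ^ 2 = ENNReal.ofReal (|u p.1 - u p.2| ^ 2 / |p.1 - p.2| ^ 2) := by
  rw [diffQuotient, ← ofReal_norm, ← ENNReal.ofReal_pow (norm_nonneg _), Real.norm_eq_abs, abs_div,
    div_pow]

theorem memHHalf_iff {u : ℝ → ℝ} :
    MemHHalf u ↔ MemLp u 2 volume ∧ MemLp (diffQuotient u) 2 volume := by
  refine and_congr_right fun hu => ?_
  have hm := aestronglyMeasurable_diffQuotient hu.aestronglyMeasurable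
  rw [memLp_two_iff hm, Measure.volume_eq_prod, lintegral_prod _ (hm.enorm.pow_const 2)]
  simp only [enorm_diffQuotient_sq]

theorem MemHHalf.memLp {u : ℝ → ℝ} (hu : MemHHalf u) : MemLp u 2 volume := hu.1

theorem MemHHalf.memLp_diffQuotient {u : ℝ → ℝ} (hu : MemHHalf u) :
    MemLp (diffQuotient u) 2 volume :=
  (memHHalf_iff.1 hu).2

/-- `H^{1/2}(ℝ)` as a vector space of functions. -/
def hHalf : Submodule ℝ (ℝ → ℝ) where
  carrier := {u | MemHHalf u}
  zero_mem' := by simp [MemHHalf]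
  add_mem' {u v} hu hv := by
    refine memHHalf_iff.2 ⟨hu.memLp.add hv.memLp, ?_⟩
    have h := hu.memLp_diffQuotient.add hv.memLp_diffQuotient
    refine h.ae_eq (ae_of_all _ fun p => ?_)
    simp only [Pi.add_apply, diffQuotient]
    ring
  smul_mem' c u hu := by
    refine memHHalf_iff.2 ⟨hu.memLp.const_smul c, ?_⟩
    refine (hu.memLp_diffQuotient.const_smul c).ae_eq (ae_of_all _ fun p => ?_)
    simp only [Pi.smul_apply, diffQuotient, smul_eq_mul]
    ring

theorem memLp_min_one_div : MemLp (fun h : ℝ => min 1 |h| / h) 2 volume := by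
  have hm : AEStronglyMeasurable (fun h : ℝ => min 1 |h| / h) volume :=
    Measurable.aestronglyMeasurable (by fun_prop)
  refine (memLp_two_iff_integrable_sq hm).2 ((integrable_inv_one_add_sq.const_mul 2).mono'
    (hm.pow 2) (ae_of_all _ fun h => ?_))
  rcases eq_or_ne h 0 with rfl | hh
  · simp
  · have h1 : (min 1 |h|) ^ 2 ≤ 1 := pow_le_one₀ (by positivity) (min_le_left _ _)
    have h2 : (min 1 |h|) ^ 2 ≤ h ^ 2 := by
      rw [← sq_abs h]
      exact pow_le_pow_left₀ (by positivity) (min_le_right _ _) 2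
    have hpos : 0 < h ^ 2 := by positivity
    rw [Real.norm_eq_abs, abs_of_nonneg (sq_nonneg _), div_pow, ← div_eq_mul_inv,
      div_le_div_iff₀ hpos (by positivity)]
    nlinarith

theorem memLp_mul_min_one_div {p : ℝ → ℝ} (hp : MemLp p 2 volume) :
    MemLp (fun q : ℝ × ℝ => p q.2 * (min 1 |q.1 - q.2| / (q.1 - q.2))) 2 volume := by
  have hm : AEStronglyMeasurable (fun q : ℝ × ℝ => p q.2 * (min 1 |q.1 - q.2| / (q.1 - q.2)))
      volume :=
    hp.aestronglyMeasurable.comp_snd.mul (Measurable.aestronglyMeasurable (by fun_prop))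
  rw [memLp_two_iff_integrable_sq hm]
  simpa only [mul_pow, ContinuousLinearMap.mul_apply', Measure.volume_eq_prod] using
    hp.integrable_sq.convolution_integrand (ContinuousLinearMap.mul ℝ ℝ)
      memLp_min_one_div.integrable_sq

theorem memHHalf_of_abs_sub_le {w u p : ℝ → ℝ} (hw : MemLp w 2 volume) (hu : MemHHalf u)
    (hp : MemLp p 2 volume)
    (h : ∀ x y, |w x - w y| ≤ |u x - u y| + min 1 |x - y| * (|p x| + |p y|)) : MemHHalf w := by
  refine memHHalf_iff.2 ⟨hw, ?_⟩
  have h2 : MemLp (fun q : ℝ × ℝ => p q.2 * (min 1 |q.1 - q.2| / (q.1 - q.2))) 2 volume :=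
    memLp_mul_min_one_div hp
  have h1 : MemLp (fun q : ℝ × ℝ => p q.1 * (min 1 |q.2 - q.1| / (q.2 - q.1))) 2 volume :=
    h2.comp_measurePreserving (Measure.measurePreserving_swap (μ := volume) (ν := volume))
  refine (hu.memLp_diffQuotient.norm.add (h1.norm.add h2.norm)).mono
    (aestronglyMeasurable_diffQuotient hw.aestronglyMeasurable) (ae_of_all _ fun q => ?_)
  have hmin : 0 ≤ min 1 |q.1 - q.2| := by positivity
  refine le_trans ?_ (le_abs_self _)
  calc ‖diffQuotient w q‖ = |w q.1 - w q.2| / |q.1 - q.2| := by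
        rw [diffQuotient, Real.norm_eq_abs, abs_div]
    _ ≤ (|u q.1 - u q.2| + min 1 |q.1 - q.2| * (|p q.1| + |p q.2|)) / |q.1 - q.2| := by
        gcongr; exact h _ _
    _ = _ := by
        simp only [Pi.add_apply, diffQuotient, Real.norm_eq_abs, abs_mul, abs_div,
          abs_sub_comm q.2 q.1, abs_of_nonneg hmin]
        ring

theorem abs_sub_le_mul_min_one {K : ℝ≥0} {η : ℝ → ℝ} (hη : LipschitzWith K η) {M : ℝ}
    (hM : ∀ x, |η x| ≤ M) (x y : ℝ) : |η x - η y| ≤ (K + 2 * M) * min 1 |x - y| := by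
  have hM0 : 0 ≤ M := (abs_nonneg _).trans (hM 0)
  have h1 : |η x - η y| ≤ 2 * M := (abs_sub _ _).trans (by linarith [hM x, hM y])
  have h2 : |η x - η y| ≤ K * |x - y| := by simpa only [Real.dist_eq] using hη.dist_le_mul x y
  rcases min_cases 1 |x - y| with ⟨h, _⟩ | ⟨h, _⟩ <;> rw [h]
  · linarith [K.coe_nonneg]
  · nlinarith [abs_nonneg (x - y)]

theorem MemHHalf.lipschitz_comp {u h : ℝ → ℝ} (hu : MemHHalf u) {K : ℝ≥0} (hh : LipschitzWith K h)
    (h0 : h 0 = 0) : MemHHalf (fun x => h (u x)) := by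
  have hle (s t : ℝ) : |h s - h t| ≤ K * |s - t| := by simpa [Real.dist_eq] using hh.dist_le_mul s t
  have hm : MemLp (fun x => h (u x)) 2 volume :=
    hu.memLp.of_le_mul (hh.continuous.comp_aestronglyMeasurable hu.memLp.aestronglyMeasurable)
      (ae_of_all _ fun x => by simpa [h0] using hle (u x) 0)
  refine memHHalf_of_abs_sub_le hm (hHalf.smul_mem K hu) MemLp.zero' fun x y => ?_
  simpa [← mul_sub, abs_mul] using hle (u x) (u y)

theorem MemHHalf.mul_lipschitz {u η : ℝ → ℝ} (hu : MemHHalf u) {K : ℝ≥0} (hη : LipschitzWith K η)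
    {M : ℝ} (hM : ∀ x, |η x| ≤ M) : MemHHalf (fun x => η x * u x) := by
  have hM0 : 0 ≤ M := (abs_nonneg _).trans (hM 0)
  have hm : MemLp (fun x => η x * u x) 2 volume :=
    hu.memLp.of_le_mul (hη.continuous.aestronglyMeasurable.mul hu.memLp.aestronglyMeasurable)
      (ae_of_all _ fun x => by
        rw [norm_mul]; exact mul_le_mul_of_nonneg_right (hM x) (norm_nonneg _))
  refine memHHalf_of_abs_sub_le hm (hHalf.smul_mem M hu) (hu.memLp.const_mul (K + 2 * M))
    fun x y => ?_
  have hC : (0 : ℝ) ≤ K + 2 * M := by positivity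
  calc |η x * u x - η y * u y| = |η x * (u x - u y) + u y * (η x - η y)| := by congr 1; ring
    _ ≤ |η x| * |u x - u y| + |u y| * |η x - η y| := by
        simpa only [abs_mul] using abs_add_le (η x * (u x - u y)) (u y * (η x - η y))
    _ ≤ M * |u x - u y| + |u y| * ((K + 2 * M) * min 1 |x - y|) := by
        gcongr
        exacts [hM x, abs_sub_le_mul_min_one hη hM x y]
    _ ≤ _ := by
        simp only [Pi.smul_apply, smul_eq_mul, ← mul_sub, abs_mul, abs_of_nonneg hM0,
          abs_of_nonneg hC]
        nlinarith [show 0 ≤ min 1 |x - y| * ((K + 2 * M) * |u x|) by positivity]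

theorem memHHalf_of_lipschitz {χ : ℝ → ℝ} {K : ℝ≥0} (hχ : LipschitzWith K χ)
    (hs : HasCompactSupport χ) : MemHHalf χ := by
  obtain ⟨M, hM⟩ := hs.exists_bound_of_continuous hχ.continuous
  have hM0 : 0 ≤ M := (norm_nonneg _).trans (hM 0)
  refine memHHalf_of_abs_sub_le (hχ.continuous.memLp_of_hasCompactSupport hs)
    (hHalf.zero_mem) (p := (tsupport χ).indicator fun _ => K + 2 * M)
    (memLp_indicator_const 2 (isClosed_tsupport χ).measurableSet _
      (Or.inr hs.isCompact.measure_lt_top.ne)) fun x y => ?_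
  have hC : (0 : ℝ) ≤ K + 2 * M := by positivity
  have hle := abs_sub_le_mul_min_one hχ hM x y
  simp only [Pi.zero_apply, sub_self, abs_zero, zero_add]
  have hmin : 0 ≤ min 1 |x - y| := by positivity
  by_cases hx : x ∈ tsupport χ
  · rw [indicator_of_mem hx, abs_of_nonneg hC]
    nlinarith [mul_nonneg hmin (abs_nonneg ((tsupport χ).indicator (fun _ => K + 2 * M) y))]
  by_cases hy : y ∈ tsupport χ
  · rw [indicator_of_mem hy, abs_of_nonneg hC]
    nlinarith [mul_nonneg hmin (abs_nonneg ((tsupport χ).indicator (fun _ => K + 2 * M) x))]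
  · simp [image_eq_zero_of_notMem_tsupport hx, image_eq_zero_of_notMem_tsupport hy, hx, hy]

theorem memHHalf_of_contDiff {χ : ℝ → ℝ} (hc : ContDiff ℝ 1 χ) (hs : HasCompactSupport χ) :
    MemHHalf χ :=
  have ⟨_, hK⟩ := hc.lipschitzWith_of_hasCompactSupport hs one_ne_zero
  memHHalf_of_lipschitz hK hs

/-- The square of the `L²` modulus of continuity of `u`. -/
def modulus (u : ℝ → ℝ) (h : ℝ) : ℝ≥0∞ :=
  ∫⁻ x, ‖u (x + h) - u x‖ₑ ^ 2

theorem aemeasurable_shift_sub {u : ℝ → ℝ} (hu : AEMeasurable u volume) :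
    AEMeasurable (fun p : ℝ × ℝ => ‖u (p.1 + p.2) - u p.1‖ₑ ^ 2) volume := by
  have hshift : AEMeasurable (fun p : ℝ × ℝ => u (p.1 + p.2)) volume :=
    hu.comp_quasiMeasurePreserving (Measure.quasiMeasurePreserving_fst.comp
      (measurePreserving_add_prod (G := ℝ) volume volume).quasiMeasurePreserving)
  exact ((hshift.sub hu.comp_fst).enorm).pow_const 2

theorem aemeasurable_modulus {u : ℝ → ℝ} (hu : AEMeasurable u volume) :
    AEMeasurable (modulus u) volume :=
  (aemeasurable_shift_sub hu).lintegral_prod_left'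

theorem MemHHalf.lintegral_modulus_lt_top {u : ℝ → ℝ} (hu : MemHHalf u) :
    ∫⁻ h, modulus u h * ENNReal.ofReal (h ^ 2)⁻¹ < ∞ := by
  have hm : AEMeasurable u volume := hu.memLp.aestronglyMeasurable.aemeasurable
  have key (x h : ℝ) : ENNReal.ofReal (|u x - u (h + x)| ^ 2 / |x - (h + x)| ^ 2)
      = ‖u (x + h) - u x‖ₑ ^ 2 * ENNReal.ofReal (h ^ 2)⁻¹ := by
    rw [← ofReal_norm, ← ENNReal.ofReal_pow (norm_nonneg _), ← ENNReal.ofReal_mul (by positivity),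
      div_eq_mul_inv, abs_sub_comm (u x), add_comm h x, Real.norm_eq_abs]
    congr 3
    simp
  calc ∫⁻ h, modulus u h * ENNReal.ofReal (h ^ 2)⁻¹
      = ∫⁻ h : ℝ, ∫⁻ x, ‖u (x + h) - u x‖ₑ ^ 2 * ENNReal.ofReal (h ^ 2)⁻¹ :=
        lintegral_congr fun h => (lintegral_mul_const' _ _ ENNReal.ofReal_ne_top).symm
    _ = ∫⁻ x, ∫⁻ h, ‖u (x + h) - u x‖ₑ ^ 2 * ENNReal.ofReal (h ^ 2)⁻¹ :=
        (lintegral_lintegral_swap ((aemeasurable_shift_sub hm).mul (by fun_prop))).symm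
    _ = ∫⁻ x, ∫⁻ y, ENNReal.ofReal (|u x - u y| ^ 2 / |x - y| ^ 2) := by
        refine lintegral_congr fun x => ?_
        rw [← lintegral_add_right_eq_self
          (fun y => ENNReal.ofReal (|u x - u y| ^ 2 / |x - y| ^ 2)) x]
        exact lintegral_congr fun h => (key x h).symm
    _ < ∞ := hu.2

/-! ### The Fourier transform and the fractional Laplacian on `H^{1/2}(ℝ)` -/

/-- The Hilbert space `L²(ℝ; ℂ)`. -/
abbrev L2 : Type := Lp ℂ 2 (volume : Measure ℝ)

theorem toL2_of_memLp {f : ℝ → ℂ} (hf : MemLp f 2 volume) : toL2 f = hf.toLp f := by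
  simp [toL2, hf]

theorem coeFn_toL2 {f : ℝ → ℂ} (hf : MemLp f 2 volume) : toL2 f =ᵐ[volume] f := by
  rw [toL2_of_memLp hf]; exact hf.coeFn_toLp

theorem toL2_congr {f g : ℝ → ℂ} (h : f =ᵐ[volume] g) : toL2 f = toL2 g := by
  by_cases hf : MemLp f 2 volume
  · rw [toL2_of_memLp hf, toL2_of_memLp (hf.ae_eq h)]
    exact (MemLp.toLp_eq_toLp_iff hf (hf.ae_eq h)).2 h
  · simp [toL2, hf, show ¬ MemLp g 2 volume from fun hg => hf (hg.ae_eq h.symm)]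

theorem lintegral_enorm_fourier_sq (U : L2) :
    ∫⁻ ξ, ‖(𝓕 U : L2) ξ‖ₑ ^ 2 = ∫⁻ x, ‖U x‖ₑ ^ 2 := by
  rw [← eLpNorm_two_sq, ← eLpNorm_two_sq, ← Lp.enorm_def, ← Lp.enorm_def, ← ofReal_norm,
    ← ofReal_norm, Lp.norm_fourier_eq]

/-- The character `ξ ↦ exp (2 π i h ξ)`, to which the Fourier transform takes the translation
`u ↦ u (· + h)`. -/
def character (h ξ : ℝ) : ℂ := Complex.exp (↑(2 * π * (h * ξ)) * Complex.I)

theorem memLp_character (h : ℝ) : MemLp (character h) ∞ (volume : Measure ℝ) :=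
  memLp_top_of_bound (Continuous.aestronglyMeasurable (by unfold character; fun_prop)) 1
    (ae_of_all _ fun _ => (Complex.norm_exp_ofReal_mul_I _).le)

/-- Multiplication by a character on `L²`. -/
def mulCharacter (h : ℝ) : L2 →L[ℂ] L2 :=
  (ContinuousLinearMap.mul ℂ ℂ).holderL volume ∞ 2 2 ((memLp_character h).toLp _)

theorem coeFn_mulCharacter (h : ℝ) (U : L2) :
    mulCharacter h U =ᵐ[volume] fun ξ => character h ξ * U ξ := by
  filter_upwards [(ContinuousLinearMap.mul ℂ ℂ).coeFn_holder (r := 2)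
    ((memLp_character h).toLp (character h)) U, (memLp_character h).coeFn_toLp] with ξ h₁ h₂
  rw [← h₂]
  exact h₁

/-- The translation `U ↦ U (· + h)` on `L²`. -/
def translate (h : ℝ) (U : L2) : L2 :=
  Lp.compMeasurePreserving (fun x => x + h) (measurePreserving_add_right volume h) U

theorem coeFn_translate (h : ℝ) {U : L2} {f : ℝ → ℂ} (hf : U =ᵐ[volume] f) :
    translate h U =ᵐ[volume] fun x => f (x + h) :=
  (Lp.coeFn_compMeasurePreserving U (measurePreserving_add_right volume h)).trans
    ((measurePreserving_add_right volume h).quasiMeasurePreserving.ae_eq_comp hf)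

theorem fourier_translate_toLp (h : ℝ) (f : SchwartzMap ℝ ℂ) :
    𝓕 (translate h (f.toLp 2)) = mulCharacter h (𝓕 (f.toLp 2) : L2) := by
  set f' : SchwartzMap ℝ ℂ := SchwartzMap.compSubConstCLM ℂ (-h) f
  have hf' : (f' : ℝ → ℂ) = f ∘ fun x => x + h := by
    ext x; simp [f', SchwartzMap.compSubConstCLM_apply]
  have htr : translate h (f.toLp 2) = f'.toLp 2 := by
    refine Lp.ext ((coeFn_translate h (f.coeFn_toLp 2)).trans ?_)
    filter_upwards [f'.coeFn_toLp 2] with x hx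
    rw [hx, hf', Function.comp_apply]
  rw [htr, SchwartzMap.toLp_fourier_eq, SchwartzMap.toLp_fourier_eq]
  refine Lp.ext ?_
  filter_upwards [(𝓕 f').coeFn_toLp 2, (𝓕 f).coeFn_toLp 2, coeFn_mulCharacter h ((𝓕 f).toLp 2)]
    with ξ h₁ h₂ h₃
  rw [h₁, h₃, h₂, SchwartzMap.fourier_coe, SchwartzMap.fourier_coe, hf']
  refine (congrFun (VectorFourier.fourierIntegral_comp_add_right Real.fourierChar
    (volume : Measure ℝ) (innerₗ ℝ) (f : ℝ → ℂ) h) ξ).trans ?_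
  rw [Circle.smul_def, Real.fourierChar_apply, smul_eq_mul]
  congr 2
  simp [mul_comm]

theorem fourier_translate (h : ℝ) (U : L2) : 𝓕 (translate h U) = mulCharacter h (𝓕 U : L2) := by
  refine DenseRange.induction_on (p := fun U : L2 => 𝓕 (translate h U) = mulCharacter h (𝓕 U))
    (SchwartzMap.denseRange_toLpCLM (p := 2) (μ := volume) (E := ℝ) (F := ℂ)
      ENNReal.ofNat_ne_top) U (isClosed_eq ?_ ?_) (fourier_translate_toLp h)
  · exact (Lp.fourierTransformₗᵢ ℝ ℂ).continuous.comp
      (Lp.isometry_compMeasurePreserving (measurePreserving_add_right volume h)).continuous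
  · exact (mulCharacter h).continuous.comp (Lp.fourierTransformₗᵢ ℝ ℂ).continuous

/-- The Fourier transform on `L²` of a real-valued function. -/
def fourierL2 (u : ℝ → ℝ) : L2 := 𝓕 (toL2 fun y => (u y : ℂ))

theorem modulus_eq_lintegral_fourierL2 {u : ℝ → ℝ} (hu : MemLp u 2 volume) (h : ℝ) :
    modulus u h = ∫⁻ ξ, ‖character h ξ - 1‖ₑ ^ 2 * ‖fourierL2 u ξ‖ₑ ^ 2 := by
  set U : L2 := toL2 fun y => (u y : ℂ)
  have hU : U =ᵐ[volume] fun y => (u y : ℂ) := coeFn_toL2 hu.ofReal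
  have hdiff : ⇑(translate h U - U) =ᵐ[volume] fun x => ((u (x + h) - u x : ℝ) : ℂ) := by
    filter_upwards [Lp.coeFn_sub (translate h U) U, coeFn_translate h hU, hU] with x h₁ h₂ h₃
    rw [h₁, Pi.sub_apply, h₂, h₃, Complex.ofReal_sub]
  have hfourier : ⇑(𝓕 (translate h U - U) : L2) =ᵐ[volume]
      fun ξ => (character h ξ - 1) * fourierL2 u ξ := by
    have hsub : (𝓕 (translate h U - U) : L2) = mulCharacter h (fourierL2 u) - fourierL2 u := by
      rw [fourierL2, ← fourier_translate]
      exact (Lp.fourierTransformₗᵢ ℝ ℂ).map_sub _ _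
    rw [hsub]
    filter_upwards [Lp.coeFn_sub (mulCharacter h (fourierL2 u)) (fourierL2 u),
      coeFn_mulCharacter h (fourierL2 u)] with ξ h₁ h₂
    rw [h₁, Pi.sub_apply, h₂, sub_mul, one_mul]
  calc modulus u h = ∫⁻ x, ‖(translate h U - U) x‖ₑ ^ 2 := by
        refine lintegral_congr_ae ?_
        filter_upwards [hdiff] with x hx
        rw [hx, ← ofReal_norm, ← ofReal_norm, Complex.norm_real]
    _ = ∫⁻ ξ, ‖(𝓕 (translate h U - U) : L2) ξ‖ₑ ^ 2 := (lintegral_enorm_fourier_sq _).symm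
    _ = _ := by
        refine lintegral_congr_ae ?_
        filter_upwards [hfourier] with ξ hξ
        rw [hξ, enorm_mul, mul_pow]

theorem two_le_norm_character_sub_one_sq {h ξ : ℝ} (h₁ : 1 / 4 ≤ |h * ξ|) (h₂ : |h * ξ| ≤ 1 / 2) :
    2 ≤ ‖character h ξ - 1‖ ^ 2 := by
  have hcos : Real.cos (2 * π * (h * ξ)) ≤ 0 := by
    rw [← Real.cos_abs, abs_mul, abs_of_pos Real.two_pi_pos]
    exact Real.cos_nonpos_of_pi_div_two_le_of_le (by nlinarith [Real.pi_pos])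
      (by nlinarith [Real.pi_pos])
  rw [character, Complex.sq_norm, Complex.normSq_apply]
  simp only [Complex.sub_re, Complex.sub_im, Complex.exp_ofReal_mul_I_re,
    Complex.exp_ofReal_mul_I_im, Complex.one_re, Complex.one_im]
  nlinarith [Real.sin_sq_add_cos_sq (2 * π * (h * ξ))]

theorem ofReal_two_mul_abs_le_lintegral_character {ξ : ℝ} (hξ : ξ ≠ 0) :
    ENNReal.ofReal (2 * |ξ|)
      ≤ ∫⁻ h : ℝ, ‖character h ξ - 1‖ₑ ^ 2 * ENNReal.ofReal (h ^ 2)⁻¹ := by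
  have : 0 < |ξ| := abs_pos.2 hξ
  set J : Set ℝ := Ioc (1 / (4 * |ξ|)) (1 / (2 * |ξ|))
  calc ENNReal.ofReal (2 * |ξ|) = ENNReal.ofReal (8 * |ξ| ^ 2) * volume J := by
        rw [Real.volume_Ioc, ← ENNReal.ofReal_mul (by positivity)]
        congr 1; field_simp; norm_num
    _ = ∫⁻ h in J, ENNReal.ofReal (8 * |ξ| ^ 2) := by rw [setLIntegral_const]
    _ ≤ ∫⁻ h in J, ‖character h ξ - 1‖ₑ ^ 2 * ENNReal.ofReal (h ^ 2)⁻¹ := by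
        refine setLIntegral_mono_ae' measurableSet_Ioc (ae_of_all _ ?_)
        rintro h ⟨hh1, hh2⟩
        have hpos : 0 < h := lt_trans (by positivity) hh1
        rw [div_lt_iff₀ (by positivity)] at hh1
        rw [le_div_iff₀ (by positivity)] at hh2
        have hchar : 2 ≤ ‖character h ξ - 1‖ ^ 2 := two_le_norm_character_sub_one_sq
          (by rw [abs_mul, abs_of_pos hpos]; linarith) (by rw [abs_mul, abs_of_pos hpos]; linarith)
        have hsq : (2 * |ξ| * h) ^ 2 ≤ 1 := pow_le_one₀ (by positivity) (by linarith)
        rw [← ofReal_norm, ← ENNReal.ofReal_pow (norm_nonneg _),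
          ← ENNReal.ofReal_mul (by positivity)]
        refine ENNReal.ofReal_le_ofReal ?_
        rw [← div_eq_mul_inv, le_div_iff₀ (by positivity)]
        nlinarith
    _ ≤ _ := setLIntegral_le_lintegral _ _

theorem MemHHalf.memLp_ofReal {u : ℝ → ℝ} (hu : MemHHalf u) :
    MemLp (fun y => (u y : ℂ)) 2 volume :=
  hu.memLp.ofReal

theorem MemHHalf.lintegral_abs_mul_fourierL2_lt_top {u : ℝ → ℝ} (hu : MemHHalf u) :
    ∫⁻ ξ : ℝ, ENNReal.ofReal (2 * |ξ|) * ‖fourierL2 u ξ‖ₑ ^ 2 < ∞ := by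
  refine lt_of_le_of_lt ?_ hu.lintegral_modulus_lt_top
  have hm : AEMeasurable (fun ξ => ‖fourierL2 u ξ‖ₑ ^ 2) volume :=
    (Lp.aestronglyMeasurable _).enorm.pow_const 2
  have hchar : Continuous fun p : ℝ × ℝ => character p.1 p.2 - 1 := by
    unfold character; fun_prop
  calc ∫⁻ ξ : ℝ, ENNReal.ofReal (2 * |ξ|) * ‖fourierL2 u ξ‖ₑ ^ 2
      ≤ ∫⁻ ξ, (∫⁻ h : ℝ, ‖character h ξ - 1‖ₑ ^ 2 * ENNReal.ofReal (h ^ 2)⁻¹)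
          * ‖fourierL2 u ξ‖ₑ ^ 2 := by
        refine lintegral_mono_ae ?_
        filter_upwards [Measure.ae_ne volume (0 : ℝ)] with ξ hξ
        gcongr
        exact ofReal_two_mul_abs_le_lintegral_character hξ
    _ = ∫⁻ ξ, ∫⁻ h : ℝ, ‖character h ξ - 1‖ₑ ^ 2 * ENNReal.ofReal (h ^ 2)⁻¹
          * ‖fourierL2 u ξ‖ₑ ^ 2 :=
        lintegral_congr fun ξ => (lintegral_mul_const' _ _ (by finiteness)).symm
    _ = ∫⁻ h : ℝ, ∫⁻ ξ, ‖character h ξ - 1‖ₑ ^ 2 * ENNReal.ofReal (h ^ 2)⁻¹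
          * ‖fourierL2 u ξ‖ₑ ^ 2 :=
        (lintegral_lintegral_swap (((hchar.measurable.enorm.pow_const 2).mul
          (by fun_prop)).aemeasurable.mul hm.comp_snd)).symm
    _ = ∫⁻ h, modulus u h * ENNReal.ofReal (h ^ 2)⁻¹ := by
        refine lintegral_congr fun h => ?_
        rw [modulus_eq_lintegral_fourierL2 hu.memLp, ← lintegral_mul_const' _ _ (by finiteness)]
        exact lintegral_congr fun ξ => mul_right_comm _ _ _

/-- The Fourier transform `|2 π ξ|^{1/2} 𝓕 u` of `(-Δ)^{1/4} u`. -/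
def symbolMul (u : ℝ → ℝ) (ξ : ℝ) : ℂ := ((|2 * π * ξ| ^ (1 / 2 : ℝ) : ℝ) : ℂ) * fourierL2 u ξ

theorem enorm_symbolMul_sq (u : ℝ → ℝ) (ξ : ℝ) :
    ‖symbolMul u ξ‖ₑ ^ 2
      = ENNReal.ofReal π * (ENNReal.ofReal (2 * |ξ|) * ‖fourierL2 u ξ‖ₑ ^ 2) := by
  rw [symbolMul, enorm_mul, mul_pow, ← mul_assoc]
  congr 1
  rw [← ofReal_norm, Complex.norm_real, ← ENNReal.ofReal_pow (norm_nonneg _),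
    ← ENNReal.ofReal_mul Real.pi_pos.le, Real.norm_eq_abs, sq_abs, ← Real.sqrt_eq_rpow,
    Real.sq_sqrt (abs_nonneg _), abs_mul, abs_of_pos Real.two_pi_pos]
  congr 1; ring

theorem MemHHalf.memLp_symbolMul {u : ℝ → ℝ} (hu : MemHHalf u) :
    MemLp (symbolMul u) 2 volume := by
  have hm : AEStronglyMeasurable (symbolMul u) volume :=
    AEStronglyMeasurable.mul (Measurable.aestronglyMeasurable (by fun_prop))
      (Lp.aestronglyMeasurable _)
  rw [memLp_two_iff hm]
  simp_rw [enorm_symbolMul_sq]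
  rw [lintegral_const_mul' _ _ ENNReal.ofReal_ne_top]
  exact ENNReal.mul_lt_top ENNReal.ofReal_lt_top hu.lintegral_abs_mul_fourierL2_lt_top

/-- The Fourier transform as a linear map `H^{1/2}(ℝ) → L²(ℝ; ℂ)`. -/
def hHalfFourier : hHalf →ₗ[ℝ] L2 :=
  ((Lp.fourierTransformₗᵢ ℝ ℂ).toLinearEquiv.toLinearMap.restrictScalars ℝ) ∘ₗ
  { toFun u := toL2 fun y => (u.1 y : ℂ)
    map_add' u v := by
      rw [toL2_of_memLp u.2.memLp_ofReal, toL2_of_memLp v.2.memLp_ofReal, ← MemLp.toLp_add,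
        ← toL2_of_memLp]
      exact congrArg toL2 (by ext; simp)
    map_smul' c u := by
      rw [toL2_of_memLp u.2.memLp_ofReal, RingHom.id_apply, ← MemLp.toLp_const_smul,
        ← toL2_of_memLp]
      exact congrArg toL2 (by ext; simp) }

theorem hHalfFourier_apply (u : hHalf) : hHalfFourier u = fourierL2 u.1 := rfl

/-- The map `u ↦ |2 π ξ|^{1/2} 𝓕 u` from `H^{1/2}(ℝ)` to `L²(ℝ; ℂ)`. -/
def hHalfSymbol : hHalf →ₗ[ℝ] L2 where
  toFun u := u.2.memLp_symbolMul.toLp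
  map_add' u v := by
    rw [← MemLp.toLp_add, MemLp.toLp_eq_toLp_iff]
    filter_upwards [Lp.coeFn_add (hHalfFourier u) (hHalfFourier v)] with ξ h
    simp only [Pi.add_apply, symbolMul, ← hHalfFourier_apply, map_add, h, mul_add]
  map_smul' c u := by
    rw [RingHom.id_apply, ← MemLp.toLp_const_smul, MemLp.toLp_eq_toLp_iff]
    filter_upwards [Lp.coeFn_smul c (hHalfFourier u)] with ξ h
    simp only [Pi.smul_apply, symbolMul, ← hHalfFourier_apply, map_smul, h, mul_smul_comm]

/-- The fractional Laplacian `(-Δ)^{1/4}` as a linear map `H^{1/2}(ℝ) → L²(ℝ)`. -/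
def hHalfLaplacian : hHalf →ₗ[ℝ] Lp ℝ 2 (volume : Measure ℝ) :=
  (Complex.reCLM.compLpL 2 volume).toLinearMap ∘ₗ
    ((Lp.fourierTransformₗᵢ ℝ ℂ).symm.toLinearEquiv.toLinearMap.restrictScalars ℝ) ∘ₗ hHalfSymbol

theorem quarterLaplacian_ae_eq (u : hHalf) :
    quarterLaplacian u.1 =ᵐ[volume] hHalfLaplacian u := by
  have h : (𝓕⁻ (toL2 (symbolMul u.1)) : L2)
      = (Lp.fourierTransformₗᵢ ℝ ℂ).symm (hHalfSymbol u) := by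
    rw [toL2_of_memLp u.2.memLp_symbolMul]; rfl
  filter_upwards [Complex.reCLM.coeFn_compLp ((Lp.fourierTransformₗᵢ ℝ ℂ).symm (hHalfSymbol u))]
    with x hx
  change ((𝓕⁻ (toL2 (symbolMul u.1)) : L2) x).re = _
  rw [h]
  exact hx.symm

theorem memLp_quarterLaplacian (u : ℝ → ℝ) : MemLp (quarterLaplacian u) 2 volume :=
  (Lp.memLp (𝓕⁻ (toL2 (symbolMul u)) : L2)).re

theorem quarterLaplacian_congr {u v : ℝ → ℝ} (h : u =ᵐ[volume] v) :
    quarterLaplacian u = quarterLaplacian v := by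
  unfold quarterLaplacian
  rw [toL2_congr (f := fun y => (u y : ℂ)) (h.fun_comp Complex.ofReal)]
  rfl

/-! ### Exponential integrability -/

theorem lintegral_exp_sq_sub_one {α : Type*} [MeasurableSpace α] {μ : Measure α} {f : α → ℝ}
    (hf : AEMeasurable f μ) {β : ℝ} (hβ : 0 ≤ β) :
    ∫⁻ x, ENNReal.ofReal (Real.exp (β * f x ^ 2) - 1) ∂μ
      = ∫⁻ t in Ioi 0, μ {x | t < |f x|}
          * ENNReal.ofReal (Real.exp (β * t ^ 2) * (β * (2 * t))) := by
  have hprim (s : ℝ) : ∫ t in (0 : ℝ)..s, Real.exp (β * t ^ 2) * (β * (2 * t))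
      = Real.exp (β * s ^ 2) - 1 := by
    rw [intervalIntegral.integral_eq_sub_of_hasDerivAt (f := fun t => Real.exp (β * t ^ 2))
      (fun t _ => by simpa using ((hasDerivAt_pow 2 t).const_mul β).exp)
      (Continuous.intervalIntegrable (by fun_prop) _ _)]
    simp
  have hcake := lintegral_comp_eq_lintegral_meas_lt_mul μ (f := fun x => |f x|)
    (g := fun t => Real.exp (β * t ^ 2) * (β * (2 * t))) (ae_of_all _ fun _ => abs_nonneg _) hf.norm
    (fun t _ => Continuous.intervalIntegrable (by fun_prop) _ _)
    ((ae_restrict_mem measurableSet_Ioi).mono fun t (ht : 0 < t) => by positivity)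
  simpa only [hprim, sq_abs] using hcake

theorem exists_forall_meas_lt_le_of_eventually {α : Type*} [MeasurableSpace α] {μ : Measure α}
    [IsFiniteMeasure μ] {f : α → ℝ} {K : ℝ} (hK : 0 ≤ K) {C : ℝ≥0∞} (hC : C < ∞)
    (h : ∀ᶠ t : ℝ in atTop, μ {x | t < |f x|} ≤ C * ENNReal.ofReal (Real.exp (-(K * t ^ 2)))) :
    ∃ C' < ∞, ∀ t > 0, μ {x | t < |f x|} ≤ C' * ENNReal.ofReal (Real.exp (-(K * t ^ 2))) := by
  obtain ⟨l, hl⟩ := eventually_atTop.1 h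
  refine ⟨C + μ univ * ENNReal.ofReal (Real.exp (K * l ^ 2)), by finiteness, fun t ht => ?_⟩
  rcases le_total l t with hlt | hlt
  · exact (hl t hlt).trans (by gcongr; exact le_self_add)
  · calc μ {x | t < |f x|} ≤ μ univ * 1 := by rw [mul_one]; exact measure_mono (subset_univ _)
      _ ≤ μ univ * ENNReal.ofReal (Real.exp (K * l ^ 2 + -(K * t ^ 2))) := by
          gcongr
          rw [ENNReal.one_le_ofReal]
          exact Real.one_le_exp (by nlinarith [pow_le_pow_left₀ ht.le hlt 2])
      _ = μ univ * ENNReal.ofReal (Real.exp (K * l ^ 2))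
            * ENNReal.ofReal (Real.exp (-(K * t ^ 2))) := by
          rw [Real.exp_add, ENNReal.ofReal_mul (Real.exp_nonneg _), mul_assoc]
      _ ≤ _ := by gcongr; exact le_add_self

theorem lintegral_exp_sq_lt_top_of_tail {α : Type*} [MeasurableSpace α] {μ : Measure α}
    [IsFiniteMeasure μ] {f : α → ℝ} (hf : AEMeasurable f μ) {β K : ℝ} (hβ : 0 ≤ β) (hβK : β < K)
    {C : ℝ≥0∞} (hC : C < ∞)
    (h : ∀ᶠ t : ℝ in atTop, μ {x | t < |f x|} ≤ C * ENNReal.ofReal (Real.exp (-(K * t ^ 2)))) :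
    ∫⁻ x, ENNReal.ofReal (Real.exp (β * f x ^ 2)) ∂μ < ∞ := by
  obtain ⟨C', hC', htail⟩ := exists_forall_meas_lt_le_of_eventually (hβ.trans hβK.le) hC h
  have hgauss : Integrable fun t => 2 * β * (t * Real.exp (-(K - β) * t ^ 2)) :=
    (integrable_mul_exp_neg_mul_sq (sub_pos.2 hβK)).const_mul _
  have hexp : ∫⁻ x, ENNReal.ofReal (Real.exp (β * f x ^ 2) - 1) ∂μ < ∞ := by
    rw [lintegral_exp_sq_sub_one hf hβ]
    calc ∫⁻ t in Ioi 0, μ {x | t < |f x|} * ENNReal.ofReal (Real.exp (β * t ^ 2) * (β * (2 * t)))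
        ≤ ∫⁻ t in Ioi 0, C' * ‖2 * β * (t * Real.exp (-(K - β) * t ^ 2))‖ₑ := by
          refine setLIntegral_mono' measurableSet_Ioi fun t (ht : 0 < t) => ?_
          refine (mul_le_mul_left (htail t ht) _).trans_eq ?_
          rw [mul_assoc, ← ENNReal.ofReal_mul (Real.exp_nonneg _), Real.enorm_eq_ofReal_abs,
            abs_of_nonneg (by positivity),
            show -(K - β) * t ^ 2 = -(K * t ^ 2) + β * t ^ 2 by ring, Real.exp_add]
          congr 2; ring
      _ ≤ C' * ∫⁻ t, ‖2 * β * (t * Real.exp (-(K - β) * t ^ 2))‖ₑ := by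
          rw [← lintegral_const_mul' _ _ hC'.ne]
          exact setLIntegral_le_lintegral _ _
      _ < ∞ := ENNReal.mul_lt_top hC' hgauss.2
  calc ∫⁻ x, ENNReal.ofReal (Real.exp (β * f x ^ 2)) ∂μ
      ≤ ∫⁻ x, (ENNReal.ofReal (Real.exp (β * f x ^ 2) - 1) + 1) ∂μ := by
        refine lintegral_mono fun x => ?_
        rw [← ENNReal.ofReal_one, ← ENNReal.ofReal_add (sub_nonneg.2 (Real.one_le_exp
          (by positivity))) zero_le_one, sub_add_cancel]
    _ < ∞ := by
        rw [lintegral_add_right _ measurable_const, lintegral_const, one_mul]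
        exact ENNReal.add_lt_top.2 ⟨hexp, measure_lt_top _ _⟩

theorem fourierInv_ae_eq_of_integrable {V : L2} (hV : Integrable V) :
    (𝓕⁻ V : L2) =ᵐ[volume] 𝓕⁻ (V : ℝ → ℂ) := by
  have hint (f : SchwartzMap ℝ ℂ) :
      ∫ x, f x • (𝓕⁻ V : L2) x = ∫ x, f x • (𝓕⁻ (V : ℝ → ℂ)) x := by
    have hflip : (-innerₗ ℝ).flip = -innerₗ ℝ := by ext; simp
    have hswap := VectorFourier.integral_fourierIntegral_smul_eq_flip (L := -innerₗ ℝ)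
      Real.continuous_fourierChar (by fun_prop) (f.integrable (μ := volume)) hV
    rw [hflip] at hswap
    refine (Lp.toTemperedDistribution_apply (𝓕⁻ V : L2) f).symm.trans ?_
    rw [← Lp.fourierInv_toTemperedDistribution_eq, TemperedDistribution.fourierInv_apply,
      Lp.toTemperedDistribution_apply, SchwartzMap.fourierInv_coe]
    exact hswap
  refine ae_eq_of_integral_contDiff_smul_eq ?_ ?_ fun g hg hs => ?_
  · exact (Lp.memLp _).locallyIntegrable one_le_two
  · exact (VectorFourier.fourierIntegral_continuous Real.continuous_fourierChar
      (L := -innerₗ ℝ) (by fun_prop) hV).locallyIntegrable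
  · have hs' : HasCompactSupport (Complex.ofRealCLM ∘ g) := hs.comp_left rfl
    simpa using hint (hs'.toSchwartzMap (Complex.ofRealCLM.contDiff.comp hg))

theorem enorm_fourierInv_le_lintegral (V : L2) :
    ∀ᵐ x, ‖(𝓕⁻ V : L2) x‖ₑ ≤ ∫⁻ ξ, ‖V ξ‖ₑ := by
  by_cases hV : Integrable V
  · filter_upwards [fourierInv_ae_eq_of_integrable hV] with x hx
    rw [hx, ← ofReal_norm, ← ofReal_integral_norm_eq_lintegral_enorm hV]
    exact ENNReal.ofReal_le_ofReal (VectorFourier.norm_fourierIntegral_le_integral_norm _ _ _ _ _)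
  · have htop : ∫⁻ ξ, ‖V ξ‖ₑ = ∞ := by
      by_contra h
      exact hV ⟨Lp.aestronglyMeasurable V, lt_top_iff_ne_top.2 h⟩
    simp [htop]

theorem lintegral_inv_two_mul_abs {a b : ℝ} (ha : 0 < a) (hab : a < b) :
    ∫⁻ ξ in abs ⁻¹' Ioc a b, ENNReal.ofReal (2 * |ξ|)⁻¹ = ENNReal.ofReal (Real.log (b / a)) := by
  have hset : MeasurableSet (abs ⁻¹' Ioc a b : Set ℝ) := measurable_norm measurableSet_Ioc
  set f : ℝ → ℝ := (Ioc a b).indicator fun r => (2 * r)⁻¹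
  have hint : ∫ ξ, f |ξ| = Real.log (b / a) := by
    have hIoi : Ioc a b ∩ Ioi 0 = Ioc a b :=
      inter_eq_left.2 fun r hr => ha.trans hr.1
    rw [integral_comp_abs, integral_indicator measurableSet_Ioc,
      Measure.restrict_restrict measurableSet_Ioc, hIoi, ← intervalIntegral.integral_of_le hab.le]
    simp_rw [mul_inv]
    rw [intervalIntegral.integral_const_mul, integral_inv_of_pos ha (ha.trans hab)]
    ring
  have hf : Integrable fun ξ => f |ξ| := .of_integral_ne_zero
    (by rw [hint]; exact (Real.log_pos ((one_lt_div ha).2 hab)).ne')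
  rw [← hint, ofReal_integral_eq_lintegral_ofReal hf (ae_of_all _ fun ξ =>
    indicator_nonneg (fun r hr => inv_nonneg.2 (by linarith [hr.1])) _),
    ← lintegral_indicator hset]
  refine lintegral_congr fun ξ => ?_
  by_cases hξ : |ξ| ∈ Ioc a b <;> simp [f, hξ]

theorem setLIntegral_enorm_band_le {V : ℝ → ℂ} {a b s : ℝ} (ha : 0 < a) (hab : a < b)
    (hs : 0 < s) :
    ∫⁻ ξ in abs ⁻¹' Ioc a b, ‖V ξ‖ₑ
      ≤ ENNReal.ofReal s * (∫⁻ ξ in abs ⁻¹' Ioi a, ENNReal.ofReal (2 * |ξ|) * ‖V ξ‖ₑ ^ 2)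
        + ENNReal.ofReal (s⁻¹ * Real.log (b / a)) := by
  have hamgm (ξ : ℝ) (hξ : |ξ| ∈ Ioc a b) : ‖V ξ‖ₑ
      ≤ ENNReal.ofReal s * (ENNReal.ofReal (2 * |ξ|) * ‖V ξ‖ₑ ^ 2)
        + ENNReal.ofReal s⁻¹ * ENNReal.ofReal (2 * |ξ|)⁻¹ := by
    have hξ₀ : 0 < |ξ| := ha.trans hξ.1
    rw [← ofReal_norm, ← ENNReal.ofReal_pow (norm_nonneg _), ← ENNReal.ofReal_mul (by positivity),
      ← ENNReal.ofReal_mul hs.le, ← ENNReal.ofReal_mul (by positivity), ← mul_inv, ← mul_assoc,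
      ← ENNReal.ofReal_add (by positivity) (by positivity)]
    refine ENNReal.ofReal_le_ofReal ?_
    have hsq : 0 ≤ (s * (2 * |ξ|) * ‖V ξ‖ - 1) ^ 2 / (s * (2 * |ξ|)) := by positivity
    have hexpand : (s * (2 * |ξ|) * ‖V ξ‖ - 1) ^ 2 / (s * (2 * |ξ|))
        = s * (2 * |ξ|) * ‖V ξ‖ ^ 2 + (s * (2 * |ξ|))⁻¹ - 2 * ‖V ξ‖ := by
      field_simp; ring
    linarith [norm_nonneg (V ξ)]
  calc ∫⁻ ξ in abs ⁻¹' Ioc a b, ‖V ξ‖ₑ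
      ≤ ∫⁻ ξ in abs ⁻¹' Ioc a b, (ENNReal.ofReal s * (ENNReal.ofReal (2 * |ξ|) * ‖V ξ‖ₑ ^ 2)
        + ENNReal.ofReal s⁻¹ * ENNReal.ofReal (2 * |ξ|)⁻¹) :=
        setLIntegral_mono' (measurable_norm measurableSet_Ioc) hamgm
    _ = ENNReal.ofReal s * (∫⁻ ξ in abs ⁻¹' Ioc a b, ENNReal.ofReal (2 * |ξ|) * ‖V ξ‖ₑ ^ 2)
        + ENNReal.ofReal (s⁻¹ * Real.log (b / a)) := by
        rw [lintegral_add_right _ (by fun_prop), lintegral_const_mul' _ _ (by finiteness),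
          lintegral_const_mul' _ _ (by finiteness), lintegral_inv_two_mul_abs ha hab,
          ← ENNReal.ofReal_mul (by positivity)]
    _ ≤ _ := by
        gcongr
        exact Ioc_subset_Ioi_self

/-- The square of the homogeneous `H^{1/2}` norm, in the normalization `∫ 2 |ξ| |𝓕 u|²`. -/
def fourierEnergy (u : ℝ → ℝ) : ℝ≥0∞ := ∫⁻ ξ, ENNReal.ofReal (2 * |ξ|) * ‖fourierL2 u ξ‖ₑ ^ 2

theorem exists_enorm_le_setLIntegral_add {u : ℝ → ℝ} (hu : MemLp u 2 volume) {S : Set ℝ}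
    (hS : MeasurableSet S) :
    ∃ H : L2, (𝓕 H : L2) =ᵐ[volume] Sᶜ.indicator (fourierL2 u) ∧
      ∀ᵐ x, ‖u x‖ₑ ≤ (∫⁻ ξ in S, ‖fourierL2 u ξ‖ₑ) + ‖H x‖ₑ := by
  set V : L2 := fourierL2 u
  set VL : L2 := ((Lp.memLp V).indicator hS).toLp
  set VH : L2 := ((Lp.memLp V).indicator hS.compl).toLp
  have hVL : VL =ᵐ[volume] S.indicator V := MemLp.coeFn_toLp _
  have hVH : VH =ᵐ[volume] Sᶜ.indicator V := MemLp.coeFn_toLp _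
  have hVL_int : ∫⁻ ξ, ‖VL ξ‖ₑ = ∫⁻ ξ in S, ‖V ξ‖ₑ := by
    rw [← lintegral_indicator hS]
    refine lintegral_congr_ae ?_
    filter_upwards [hVL] with ξ hξ
    rw [hξ, enorm_indicator_eq_indicator_enorm]
  have hsum : toL2 (fun y => (u y : ℂ)) = 𝓕⁻ VL + (𝓕⁻ VH : L2) := by
    have hV : VL + VH = V := by
      refine Lp.ext ?_
      filter_upwards [Lp.coeFn_add VL VH, hVL, hVH] with ξ h₁ h₂ h₃
      rw [h₁, Pi.add_apply, h₂, h₃, indicator_self_add_compl_apply]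
    rw [← FourierTransform.fourierInv_add, hV]
    exact (FourierTransform.fourierInv_fourier_eq _).symm
  refine ⟨𝓕⁻ VH, by rwa [FourierTransform.fourier_fourierInv_eq], ?_⟩
  filter_upwards [enorm_fourierInv_le_lintegral VL,
    coeFn_toL2 (f := fun y => (u y : ℂ)) hu.ofReal,
    Lp.coeFn_add (𝓕⁻ VL : L2) (𝓕⁻ VH : L2)] with x h₁ h₂ h₃
  rw [hsum, h₃, Pi.add_apply] at h₂
  rw [← hVL_int, ← ofReal_norm, ← Complex.norm_real, ofReal_norm, ← h₂]
  exact (enorm_add_le _ _).trans (by gcongr)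

theorem lintegral_enorm_sq_le_of_fourier_eq_indicator {u : ℝ → ℝ} {R : ℝ} (hR : 0 < R) {H : L2}
    (hH : (𝓕 H : L2) =ᵐ[volume] (abs ⁻¹' Iic R)ᶜ.indicator (fourierL2 u)) :
    ∫⁻ x, ‖H x‖ₑ ^ 2 ≤ ENNReal.ofReal (2 * R)⁻¹ * fourierEnergy u := by
  rw [← lintegral_enorm_fourier_sq, fourierEnergy, ← lintegral_const_mul' _ _ (by finiteness)]
  refine lintegral_mono_ae ?_
  filter_upwards [hH] with ξ hξ
  rw [hξ]
  by_cases h : |ξ| ≤ R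
  · simp [h]
  · have hone : 1 ≤ ENNReal.ofReal (2 * R)⁻¹ * ENNReal.ofReal (2 * |ξ|) := by
      rw [← ENNReal.ofReal_mul (by positivity), ENNReal.one_le_ofReal,
        inv_mul_eq_div, one_le_div (by positivity)]
      linarith
    rw [indicator_of_mem (by simpa using h), ← mul_assoc]
    exact le_mul_of_one_le_left zero_le hone

theorem volume_two_mul_lt_abs_le {u : ℝ → ℝ} (hu : MemLp u 2 volume) {R l : ℝ} (hR : 0 < R)
    (hl : 0 < l) (hlow : ∫⁻ ξ in abs ⁻¹' Iic R, ‖fourierL2 u ξ‖ₑ ≤ ENNReal.ofReal l) :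
    volume {x | 2 * l < |u x|} ≤ ENNReal.ofReal (2 * R * l ^ 2)⁻¹ * fourierEnergy u := by
  obtain ⟨H, hfourier, hle⟩ := exists_enorm_le_setLIntegral_add hu (S := abs ⁻¹' Iic R)
    (measurable_norm measurableSet_Iic)
  have hH := lintegral_enorm_sq_le_of_fourier_eq_indicator hR hfourier
  have hsub : {x | 2 * l < |u x|} ≤ᵐ[volume] {x | ENNReal.ofReal (l ^ 2) ≤ ‖H x‖ₑ ^ 2} := by
    filter_upwards [hle] with x h (hx : 2 * l < |u x|)
    rw [ENNReal.ofReal_pow hl.le]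
    refine pow_le_pow_left₀ zero_le ((ENNReal.add_le_add_iff_left
      (a := ENNReal.ofReal l) ENNReal.ofReal_ne_top).1 ?_) 2
    calc ENNReal.ofReal l + ENNReal.ofReal l = ENNReal.ofReal (2 * l) := by
          rw [← ENNReal.ofReal_add hl.le hl.le, two_mul]
      _ ≤ ‖u x‖ₑ := by
          rw [Real.enorm_eq_ofReal_abs]; exact ENNReal.ofReal_le_ofReal hx.le
      _ ≤ ENNReal.ofReal l + ‖H x‖ₑ := h.trans (by gcongr)
  have hcheb := (mul_meas_ge_le_lintegral₀ ((Lp.aestronglyMeasurable H).enorm.pow_const 2)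
    (ENNReal.ofReal (l ^ 2))).trans hH
  refine (measure_mono_ae hsub).trans ?_
  rw [mul_comm (2 * R), mul_inv, ENNReal.ofReal_mul (by positivity), mul_assoc,
    ENNReal.ofReal_inv_of_pos (by positivity), mul_comm, ← div_eq_mul_inv,
    ENNReal.le_div_iff_mul_le (Or.inl (by positivity)) (Or.inl ENNReal.ofReal_ne_top), mul_comm]
  exact hcheb

theorem MemHHalf.tendsto_fourierEnergy_tail {u : ℝ → ℝ} (hu : MemHHalf u) :
    Tendsto (fun R => ∫⁻ ξ in abs ⁻¹' Ioi R, ENNReal.ofReal (2 * |ξ|) * ‖fourierL2 u ξ‖ₑ ^ 2)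
      atTop (𝓝 0) := by
  have hset (R : ℝ) : MeasurableSet (abs ⁻¹' Ioi R : Set ℝ) := measurable_norm measurableSet_Ioi
  have hm : AEMeasurable fun ξ => ENNReal.ofReal (2 * |ξ|) * ‖fourierL2 u ξ‖ₑ ^ 2 :=
    AEMeasurable.mul (by fun_prop) ((Lp.aestronglyMeasurable _).enorm.pow_const 2)
  simp_rw [← lintegral_indicator (hset _)]
  rw [← lintegral_zero]
  refine tendsto_lintegral_filter_of_dominated_convergence' _
    (Eventually.of_forall fun R => hm.indicator (hset R))
    (Eventually.of_forall fun R => ae_of_all _ fun ξ => indicator_le_self _ _ ξ)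
    hu.lintegral_abs_mul_fourierL2_lt_top.ne (ae_of_all _ fun ξ => ?_)
  refine tendsto_const_nhds.congr' ?_
  filter_upwards [eventually_ge_atTop |ξ|] with R hR
  exact (indicator_of_notMem (by simpa using hR) _).symm

theorem setLIntegral_enorm_Iic_lt_top (V : L2) (R : ℝ) :
    ∫⁻ ξ in abs ⁻¹' Iic R, ‖V ξ‖ₑ < ∞ := by
  have hball : (abs ⁻¹' Iic R : Set ℝ) = Icc (-R) R := by ext; simp [abs_le]
  rw [hball]
  exact (((Lp.memLp V).restrict _).integrable one_le_two).2

theorem MemHHalf.eventually_setLIntegral_fourierL2_le {u : ℝ → ℝ} (hu : MemHHalf u) {K : ℝ}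
    (hK : 0 < K) :
    ∀ᶠ t : ℝ in atTop, ∫⁻ ξ in abs ⁻¹' Iic (Real.exp (K * t ^ 2)), ‖fourierL2 u ξ‖ₑ
      ≤ ENNReal.ofReal (t / 2) := by
  obtain ⟨R₀, htail, hR₀⟩ := ((hu.tendsto_fourierEnergy_tail.eventually_le_const
    (u := ENNReal.ofReal (1 / (64 * K))) (by positivity)).and (eventually_ge_atTop 1)).exists
  have hlow := setLIntegral_enorm_Iic_lt_top (fourierL2 u) R₀
  set c := ∫⁻ ξ in abs ⁻¹' Iic R₀, ‖fourierL2 u ξ‖ₑ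
  have hexp : Tendsto (fun t => Real.exp (K * t ^ 2)) atTop atTop :=
    Real.tendsto_exp_atTop.comp ((tendsto_pow_atTop two_ne_zero).const_mul_atTop hK)
  filter_upwards [eventually_gt_atTop 0, eventually_ge_atTop (4 * c.toReal),
    hexp.eventually_gt_atTop R₀] with t ht htc htR
  have hunion : (abs ⁻¹' Iic (Real.exp (K * t ^ 2)) : Set ℝ)
      = abs ⁻¹' Iic R₀ ∪ abs ⁻¹' Ioc R₀ (Real.exp (K * t ^ 2)) := by
    rw [← preimage_union, Iic_union_Ioc_eq_Iic htR.le]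
  have hlog : (8 * K * t)⁻¹ * Real.log (Real.exp (K * t ^ 2) / R₀) ≤ t / 8 := by
    rw [Real.log_div (Real.exp_ne_zero _) (by positivity), Real.log_exp, inv_mul_le_iff₀
      (by positivity)]
    linarith [Real.log_nonneg hR₀]
  rw [hunion]
  calc _ ≤ c + (ENNReal.ofReal (8 * K * t) * ENNReal.ofReal (1 / (64 * K))
        + ENNReal.ofReal (t / 8)) := by
        refine (lintegral_union_le _ _ _).trans (add_le_add_right
          ((setLIntegral_enorm_band_le (by positivity) htR (s := 8 * K * t)
            (by positivity)).trans ?_) _)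
        gcongr
    _ ≤ ENNReal.ofReal (t / 4) + (ENNReal.ofReal (t / 8) + ENNReal.ofReal (t / 8)) := by
        rw [← ENNReal.ofReal_mul (by positivity), ← ENNReal.ofReal_toReal hlow.ne]
        gcongr
        · linarith
        · exact le_of_eq (by field_simp; norm_num)
    _ = ENNReal.ofReal (t / 2) := by
        rw [← ENNReal.ofReal_add (by positivity) (by positivity),
          ← ENNReal.ofReal_add (by positivity) (by positivity)]
        congr 1; ring

theorem MemHHalf.eventually_volume_lt_abs_le {u : ℝ → ℝ} (hu : MemHHalf u) {K : ℝ} (hK : 0 < K) :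
    ∃ C < ∞, ∀ᶠ t : ℝ in atTop,
      volume {x | t < |u x|} ≤ C * ENNReal.ofReal (Real.exp (-(K * t ^ 2))) := by
  refine ⟨ENNReal.ofReal 2 * fourierEnergy u,
    ENNReal.mul_lt_top (by finiteness) hu.lintegral_abs_mul_fourierL2_lt_top, ?_⟩
  filter_upwards [hu.eventually_setLIntegral_fourierL2_le hK, eventually_ge_atTop 1] with t hlow ht
  calc volume {x | t < |u x|} = volume {x | 2 * (t / 2) < |u x|} := by
        rw [mul_div_cancel₀ t two_ne_zero]
    _ ≤ ENNReal.ofReal (2 * Real.exp (K * t ^ 2) * (t / 2) ^ 2)⁻¹ * fourierEnergy u :=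
        volume_two_mul_lt_abs_le hu.memLp (Real.exp_pos _) (by linarith) hlow
    _ ≤ ENNReal.ofReal (2 * Real.exp (-(K * t ^ 2))) * fourierEnergy u := by
        gcongr
        rw [Real.exp_neg, inv_le_iff_one_le_mul₀ (by positivity)]
        field_simp
        nlinarith
    _ = _ := by rw [ENNReal.ofReal_mul zero_le_two]; ring

theorem MemHHalf.setLIntegral_exp_lt_top {u : ℝ → ℝ} (hu : MemHHalf u) {β : ℝ} (hβ : 0 ≤ β)
    {B : Set ℝ} (hB : volume B < ∞) :
    ∫⁻ x in B, ENNReal.ofReal (Real.exp (β * u x ^ 2)) < ∞ := by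
  have : IsFiniteMeasure (volume.restrict B) := isFiniteMeasure_restrict.2 hB.ne
  obtain ⟨C, hC, h⟩ := hu.eventually_volume_lt_abs_le (K := β + 1) (by positivity)
  exact lintegral_exp_sq_lt_top_of_tail hu.memLp.1.aemeasurable.restrict hβ (lt_add_one β) hC
    (h.mono fun t ht => (Measure.restrict_apply_le _ _).trans ht)

theorem MemHHalf.setLIntegral_le_abs_exp_lt_top {u : ℝ → ℝ} (hu : MemHHalf u) {β : ℝ}
    (hβ : 0 ≤ β) {δ : ℝ} (hδ : 0 < δ) :
    ∫⁻ x in {x | δ ≤ |u x|}, ENNReal.ofReal (Real.exp (β * u x ^ 2)) < ∞ := by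
  lift δ to ℝ≥0 using hδ.le
  exact hu.setLIntegral_exp_lt_top hβ
    (hu.memLp.meas_ge_lt_top two_ne_zero ENNReal.ofNat_ne_top (NNReal.coe_pos.1 hδ).ne')

/-! ### Functions in `H^{1/2}(ℝ)` have no gaps in their range -/

theorem modulus_two_mul_le {v : ℝ → ℝ} (hv : AEMeasurable v volume)
    (h01 : ∀ᵐ x, v x = 0 ∨ v x = 1) (h : ℝ) : modulus v (2 * h) ≤ 2 * modulus v h := by
  have hshift (t : ℝ) : ∀ᵐ x, v (x + t) = 0 ∨ v (x + t) = 1 :=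
    (measurePreserving_add_right volume t).quasiMeasurePreserving.ae h01
  have hm : AEMeasurable (fun x => ‖v (x + h) - v x‖ₑ ^ 2) volume :=
    ((hv.comp_quasiMeasurePreserving
      (measurePreserving_add_right volume h).quasiMeasurePreserving).sub hv).enorm.pow_const 2
  calc modulus v (2 * h)
      ≤ ∫⁻ x, (‖v (x + h) - v x‖ₑ ^ 2 + ‖v (x + h + h) - v (x + h)‖ₑ ^ 2) := by
        refine lintegral_mono_ae ?_
        filter_upwards [h01, hshift h, hshift (2 * h)] with x h1 h2 h3
        rw [show x + h + h = x + 2 * h by ring]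
        rcases h1 with h1 | h1 <;> rcases h2 with h2 | h2 <;> rcases h3 with h3 | h3 <;>
          simp [h1, h2, h3]
    _ = modulus v h + modulus v h := by
        rw [lintegral_add_left' hm,
          lintegral_add_right_eq_self (fun x => ‖v (x + h) - v x‖ₑ ^ 2) h, modulus]
    _ = _ := (two_mul _).symm

theorem setLIntegral_Ioc_two_mul (F : ℝ → ℝ≥0∞) (T : ℝ) :
    ∫⁻ h in Ioc 0 (2 * T), F h = 2 * ∫⁻ h in Ioc 0 T, F (2 * h) := by
  have hme : MeasurableEmbedding (fun x : ℝ => 2 * x) :=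
    (Homeomorph.mulLeft₀ (2 : ℝ) two_ne_zero).measurableEmbedding
  have hpre : (fun x : ℝ => 2 * x) ⁻¹' Ioc 0 (2 * T) = Ioc 0 T := by
    ext x
    simp
  conv_lhs => rw [← Real.smul_map_volume_mul_left (a := 2) two_ne_zero]
  rw [Measure.restrict_smul, lintegral_smul_measure, hme.restrict_map, hme.lintegral_map, hpre]
  simp

theorem MemHHalf.setLIntegral_modulus_eq_zero {v : ℝ → ℝ} (hv : MemHHalf v)
    (h01 : ∀ᵐ x, v x = 0 ∨ v x = 1) {T : ℝ} (hT : 0 < T) :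
    ∫⁻ h in Ioc T (2 * T), modulus v h = 0 := by
  have hm : AEMeasurable v volume := hv.memLp.aestronglyMeasurable.aemeasurable
  set F : ℝ → ℝ≥0∞ := fun h => modulus v h * ENNReal.ofReal (h ^ 2)⁻¹
  have hscale (h : ℝ) : 2 * F (2 * h) ≤ F h := by
    calc 2 * F (2 * h) ≤ 2 * ((2 * modulus v h) * ENNReal.ofReal ((2 * h) ^ 2)⁻¹) :=
          mul_le_mul_right (mul_le_mul_left (modulus_two_mul_le hm h01 h) _) _
      _ = modulus v h * (ENNReal.ofReal 4 * ENNReal.ofReal ((2 * h) ^ 2)⁻¹) := by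
          rw [show ENNReal.ofReal 4 = 2 * 2 by norm_num]; ring
      _ = F h := by
          rw [← ENNReal.ofReal_mul (by norm_num), mul_pow, mul_inv, ← mul_assoc]
          norm_num [F]
  have hle : ∫⁻ h in Ioc 0 (2 * T), F h ≤ ∫⁻ h in Ioc 0 T, F h := by
    rw [setLIntegral_Ioc_two_mul, ← lintegral_const_mul' _ _ ENNReal.ofNat_ne_top]
    exact lintegral_mono hscale
  have hfin : ∫⁻ h in Ioc 0 T, F h ≠ ∞ :=
    ((setLIntegral_le_lintegral _ _).trans_lt hv.lintegral_modulus_lt_top).ne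
  have hzero : ∫⁻ h in Ioc T (2 * T), F h = 0 := by
    rw [← Ioc_union_Ioc_eq_Ioc hT.le (by linarith : T ≤ 2 * T),
      lintegral_union measurableSet_Ioc (Ioc_disjoint_Ioc_of_le le_rfl)] at hle
    exact nonpos_iff_eq_zero.1 (ENNReal.le_of_add_le_add_left hfin (by simpa using hle))
  have hF : AEMeasurable F volume := (aemeasurable_modulus hm).mul (by fun_prop)
  rw [lintegral_eq_zero_iff' hF.restrict] at hzero
  refine (setLIntegral_congr_fun_ae measurableSet_Ioc ?_).trans lintegral_zero
  filter_upwards [(ae_restrict_iff' measurableSet_Ioc).1 hzero] with h hFh hh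
  have hpos : 0 < h := hT.trans hh.1
  refine (mul_eq_zero.1 (hFh hh)).resolve_right ?_
  simpa using hpos.ne'

/-- The Gagliardo energy of an indicator function on shifts in `(0, 2T]` is at most that on shifts
in `(0, T]`, so almost every shift preserves the function. -/
theorem MemHHalf.ae_eq_zero_of_ae_eq_zero_or_one {v : ℝ → ℝ} (hv : MemHHalf v)
    (h01 : ∀ᵐ x, v x = 0 ∨ v x = 1) : v =ᵐ[volume] 0 := by
  have hm : AEMeasurable v volume := hv.memLp.aestronglyMeasurable.aemeasurable
  by_contra hne
  suffices h : ∀ T : ℝ, 0 < T → ENNReal.ofReal T ≤ ∫⁻ x, ‖v x‖ₑ ^ 2 by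
    have hfin := (memLp_two_iff hv.memLp.aestronglyMeasurable).1 hv.memLp
    have := h ((∫⁻ x, ‖v x‖ₑ ^ 2).toReal + 1) (by positivity)
    rw [ENNReal.ofReal_le_iff_le_toReal hfin.ne] at this
    linarith
  intro T hT
  have hpm : AEMeasurable (fun p : ℝ × ℝ => ‖v (p.1 + p.2) - v p.1‖ₑ ^ 2)
      (volume.prod (volume.restrict (Ioc T (2 * T)))) :=
    (aemeasurable_shift_sub hm).mono_ac
      (Measure.AbsolutelyContinuous.prod (by rfl) Measure.restrict_le_self.absolutelyContinuous)
  have hswap : ∫⁻ x, ∫⁻ h in Ioc T (2 * T), ‖v (x + h) - v x‖ₑ ^ 2 = 0 := by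
    rw [lintegral_lintegral_swap hpm]
    exact hv.setLIntegral_modulus_eq_zero h01 hT
  rw [lintegral_eq_zero_iff' hpm.lintegral_prod_right'] at hswap
  obtain ⟨x, hx, hx01, hx0⟩ := ((not_eventually.1 hne).and_eventually (h01.and hswap)).exists
  have hx1 : v x = 1 := hx01.resolve_left hx
  have hvs : AEMeasurable (fun h => v (x + h)) volume :=
    hm.comp_quasiMeasurePreserving (measurePreserving_add_left volume x).quasiMeasurePreserving
  have hinv : ∀ᵐ h ∂(volume.restrict (Ioc T (2 * T))), v (x + h) = 1 := by
    have hzero := (lintegral_eq_zero_iff' ((hvs.sub_const (v x)).enorm.pow_const 2).restrict).1 hx0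
    filter_upwards [hzero] with h hh
    have hdiff : v (x + h) - v x = 0 := by simpa using hh
    linarith
  calc ENNReal.ofReal T = ∫⁻ _ in Ioc T (2 * T), 1 := by simp [two_mul]
    _ = ∫⁻ h in Ioc T (2 * T), ‖v (x + h)‖ₑ ^ 2 :=
        lintegral_congr_ae (hinv.mono fun _ hh => by simp [hh])
    _ ≤ ∫⁻ h, ‖v (x + h)‖ₑ ^ 2 := setLIntegral_le_lintegral _ _
    _ = ∫⁻ y, ‖v y‖ₑ ^ 2 := lintegral_add_left_eq_self (fun y => ‖v y‖ₑ ^ 2) x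

theorem MemHHalf.ae_le_of_gap {u : ℝ → ℝ} (hu : MemHHalf u) {s ε : ℝ} (hs : 0 < s) (hε : 0 < ε)
    (h : ∀ᵐ x, u x ≤ s ∨ s + ε ≤ u x) : ∀ᵐ x, u x ≤ s := by
  set jump : ℝ → ℝ := fun t => max 0 (min 1 (ε⁻¹ * (t - s)))
  have hjump : LipschitzWith ‖ε⁻¹‖₊ jump := by
    refine ((LipschitzWith.of_dist_le_mul fun a b => ?_).const_min 1).const_max 0
    simp only [Real.dist_eq, coe_nnnorm, Real.norm_eq_abs, ← abs_mul]
    exact le_of_eq (by congr 1; ring)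
  have hlow {t : ℝ} (ht : t ≤ s) : jump t = 0 :=
    max_eq_left ((min_le_right _ _).trans
      (mul_nonpos_of_nonneg_of_nonpos (by positivity) (by linarith)))
  have hhigh {t : ℝ} (ht : s + ε ≤ t) : jump t = 1 := by
    have : 1 ≤ ε⁻¹ * (t - s) := by
      rw [inv_mul_eq_div, le_div_iff₀ hε]
      linarith
    simp [jump, this]
  have hzero := (hu.lipschitz_comp hjump (hlow hs.le)).ae_eq_zero_of_ae_eq_zero_or_one
    (h.mono fun x hx => hx.imp hlow hhigh)
  filter_upwards [h, hzero] with x hx hx0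
  refine hx.resolve_right fun hhx => one_ne_zero (α := ℝ) ?_
  rw [← hhigh hhx]
  exact hx0

theorem MemHHalf.ae_nonpos_of_mem {u : ℝ → ℝ} (hu : MemHHalf u) {Z : Set ℝ} (hZ : IsClosed Z)
    (hZi : interior Z = ∅) (h : ∀ᵐ x, u x ∈ Z) : ∀ᵐ x, u x ≤ 0 := by
  have hle (n : ℕ) : ∀ᵐ x, u x ≤ 1 / ((n : ℝ) + 1) := by
    obtain ⟨s, hsZ, hs0, hsn⟩ : ∃ s ∈ Zᶜ, 0 < s ∧ s < 1 / ((n : ℝ) + 1) :=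
      (interior_eq_empty_iff_dense_compl.1 hZi).exists_between Nat.one_div_pos_of_nat
    obtain ⟨ε, hε, hball⟩ := Metric.isOpen_iff.1 hZ.isOpen_compl s hsZ
    refine (hu.ae_le_of_gap hs0 hε (h.mono fun x hx => ?_)).mono fun x hx => hx.trans hsn.le
    by_contra! hgap
    refine hball ?_ hx
    rw [Metric.mem_ball, Real.dist_eq, abs_lt]
    constructor <;> linarith
  filter_upwards [ae_all_iff.2 hle] with x hx
  exact ge_of_tendsto' tendsto_one_div_add_atTop_nhds_zero_nat hx

theorem MemHHalf.ae_eq_zero_of_mem {u : ℝ → ℝ} (hu : MemHHalf u) {Z : Set ℝ} (hZ : IsClosed Z)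
    (hZi : interior Z = ∅) (h : ∀ᵐ x, u x ∈ Z) : u =ᵐ[volume] 0 := by
  have hneg : interior (Neg.neg ⁻¹' Z) = ∅ := by
    rw [← Homeomorph.coe_neg, ← Homeomorph.preimage_interior, hZi, preimage_empty]
  filter_upwards [hu.ae_nonpos_of_mem hZ hZi h,
    MemHHalf.ae_nonpos_of_mem (hHalf.neg_mem hu) (hZ.preimage continuous_neg) hneg
      (by simpa using h)] with x hx hnx
  exact le_antisymm hx (neg_nonpos.1 hnx)

/-! ### The logarithmic energy -/

theorem integrable_posLog_inv : Integrable fun s : ℝ => log⁺ s⁻¹ := by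
  have hlog : IntegrableOn (fun s => -Real.log s) (Icc (-1 : ℝ) 1) := by
    rw [integrableOn_Icc_iff_integrableOn_Ioc,
      ← intervalIntegrable_iff_integrableOn_Ioc_of_le (by norm_num)]
    exact intervalIntegral.intervalIntegrable_log'.neg
  refine (hlog.integrable_indicator measurableSet_Icc).congr (ae_of_all _ fun s => ?_)
  simp only [indicator_apply, mem_Icc, ← abs_le]
  split_ifs with hs
  · rcases eq_or_ne s 0 with rfl | h0
    · simp
    · rw [Real.posLog_eq_log, Real.log_inv]
      rw [abs_inv]
      exact (one_le_inv₀ (abs_pos.2 h0)).2 hs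
  · rw [eq_comm, Real.posLog_eq_zero_iff, abs_inv]
    exact inv_le_one_of_one_le₀ (not_le.1 hs).le

/-- The logarithmic kernel `log (1 / |x - y|)`, equal to `0` on the diagonal. -/
def logKernel (x y : ℝ) : ℝ := Real.log (1 / |x - y|)

/-- The weight that dominates the logarithmic kernel at infinity:
`log⁺ |x - y| ≤ logWeight x * logWeight y`. -/
def logWeight (y : ℝ) : ℝ := 1 + log⁺ y

theorem one_le_logWeight (y : ℝ) : 1 ≤ logWeight y :=
  le_add_of_nonneg_right Real.posLog_nonneg

theorem logWeight_pos (y : ℝ) : 0 < logWeight y :=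
  one_pos.trans_le (one_le_logWeight y)

theorem continuous_logWeight : Continuous logWeight :=
  continuous_const.add Real.continuous_posLog

theorem posLog_sub_le (x y : ℝ) : log⁺ (x - y) ≤ logWeight x * logWeight y := by
  have hadd := Real.posLog_add (x := x) (y := -y)
  have hx : 0 ≤ log⁺ x := Real.posLog_nonneg
  have hy : 0 ≤ log⁺ y := Real.posLog_nonneg
  rw [Real.posLog_neg, ← sub_eq_add_neg] at hadd
  unfold logWeight
  nlinarith [Real.log_two_lt_d9, mul_nonneg hx hy]

theorem logKernel_comm (x y : ℝ) : logKernel x y = logKernel y x := by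
  rw [logKernel, logKernel, abs_sub_comm]

theorem measurable_logKernel : Measurable fun p : ℝ × ℝ => logKernel p.1 p.2 := by
  unfold logKernel; fun_prop

theorem abs_logKernel_le (x y : ℝ) :
    |logKernel x y| ≤ log⁺ (x - y)⁻¹ + logWeight x * logWeight y := by
  have hsplit : logKernel x y = log⁺ (x - y)⁻¹ - log⁺ (x - y) := by
    rw [logKernel, one_div, Real.log_inv, Real.log_abs, ← Real.posLog_sub_posLog_inv, neg_sub]
  have hpos : 0 ≤ log⁺ (x - y)⁻¹ := Real.posLog_nonneg
  have hneg : 0 ≤ log⁺ (x - y) := Real.posLog_nonneg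
  have hweight := posLog_sub_le x y
  rw [hsplit, abs_le]
  constructor <;> linarith

/-- Densities with absolutely convergent logarithmic energy: square integrability controls the
kernel near the diagonal, the logarithmic moment controls it at infinity. -/
structure LogAdmissible (μ : Measure ℝ) (F : ℝ → ℝ) : Prop where
  memLp : MemLp F 2 μ
  integrable : Integrable (fun y => logWeight y * F y) μ

namespace LogAdmissible

variable {μ : Measure ℝ} {F H : ℝ → ℝ}

theorem mono (hH : LogAdmissible μ H) (hF : AEStronglyMeasurable F μ)
    (h : ∀ᵐ x ∂μ, |F x| ≤ |H x|) : LogAdmissible μ F := by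
  refine ⟨hH.memLp.mono hF h, hH.integrable.mono
    (continuous_logWeight.aestronglyMeasurable.mul hF) ?_⟩
  filter_upwards [h] with x hx
  rw [norm_mul, norm_mul]
  exact mul_le_mul_of_nonneg_left hx (norm_nonneg _)

theorem abs (hF : LogAdmissible μ F) : LogAdmissible μ fun x => |F x| :=
  hF.mono hF.memLp.aestronglyMeasurable.norm (ae_of_all _ fun x => (abs_abs (F x)).le)

theorem add (hF : LogAdmissible μ F) (hH : LogAdmissible μ H) :
    LogAdmissible μ fun x => F x + H x := by
  refine ⟨hF.memLp.add hH.memLp, ?_⟩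
  simp only [mul_add]
  exact hF.integrable.add hH.integrable

theorem of_bounded_support (hμ : μ ≤ volume) {R : ℝ} (hF : MemLp F 2 μ)
    (h0 : ∀ᵐ x ∂μ, R < |x| → F x = 0) : LogAdmissible μ F := by
  have hweight : MemLp ((Icc (-R) R).indicator logWeight) 2 μ := by
    obtain ⟨C, hC⟩ := isCompact_Icc.exists_bound_of_continuousOn
      (continuous_logWeight.continuousOn (s := Icc (-R) R))
    have : IsFiniteMeasure (μ.restrict (Icc (-R) R)) :=
      isFiniteMeasure_restrict.2 ((hμ _).trans_lt measure_Icc_lt_top).ne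
    rw [memLp_indicator_iff_restrict measurableSet_Icc]
    exact .of_bound continuous_logWeight.aestronglyMeasurable C
      (ae_restrict_of_forall_mem measurableSet_Icc hC)
  refine ⟨hF, (hweight.integrable_mul hF).congr ?_⟩
  filter_upwards [h0] with x hx
  simp only [Pi.mul_apply, indicator_apply, mem_Icc, ← abs_le]
  split_ifs with hxR
  · rfl
  · rw [hx (not_le.1 hxR), mul_zero, mul_zero]

theorem integrable_prod {S : Set ℝ} (hF : LogAdmissible (volume.restrict S) F)
    (hH : LogAdmissible (volume.restrict S) H) :
    Integrable (fun p : ℝ × ℝ => logKernel p.1 p.2 * F p.1 * H p.2)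
      ((volume.restrict S).prod (volume.restrict S)) := by
  have hdiag : ∀ {K : ℝ → ℝ}, LogAdmissible (volume.restrict S) K →
      Integrable (fun p : ℝ × ℝ => K p.2 ^ 2 * log⁺ (p.1 - p.2)⁻¹)
        ((volume.restrict S).prod (volume.restrict S)) := fun hK =>
    (hK.memLp.integrable_sq.convolution_integrand (ContinuousLinearMap.mul ℝ ℝ)
      integrable_posLog_inv).mono_measure (Measure.prod_mono Measure.restrict_le_self le_rfl)
  have hdiag' : Integrable (fun p : ℝ × ℝ => F p.1 ^ 2 * log⁺ (p.1 - p.2)⁻¹)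
      ((volume.restrict S).prod (volume.restrict S)) := by
    refine (hdiag hF).swap.congr (ae_of_all _ fun p => ?_)
    simp only [Function.comp_apply, Prod.fst_swap, Prod.snd_swap]
    rw [← neg_sub, inv_neg, Real.posLog_neg]
  refine ((hdiag'.add (hdiag hH)).add (hF.integrable.abs.mul_prod hH.integrable.abs)).mono'
    ((measurable_logKernel.aestronglyMeasurable.mul hF.memLp.aestronglyMeasurable.comp_fst).mul
      hH.memLp.aestronglyMeasurable.comp_snd) (ae_of_all _ fun p => ?_)
  have hlog : 0 ≤ log⁺ (p.1 - p.2)⁻¹ := Real.posLog_nonneg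
  have hamgm : |F p.1| * |H p.2| ≤ F p.1 ^ 2 + H p.2 ^ 2 := by
    nlinarith [two_mul_le_add_sq |F p.1| |H p.2|, sq_abs (F p.1), sq_abs (H p.2),
      abs_nonneg (F p.1), abs_nonneg (H p.2)]
  simp only [Pi.add_apply, Real.norm_eq_abs, abs_mul, abs_of_pos (logWeight_pos _)]
  calc |logKernel p.1 p.2| * |F p.1| * |H p.2|
      ≤ (log⁺ (p.1 - p.2)⁻¹ + logWeight p.1 * logWeight p.2) * (|F p.1| * |H p.2|) := by
        rw [mul_assoc]
        exact mul_le_mul_of_nonneg_right (abs_logKernel_le _ _) (by positivity)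
    _ ≤ log⁺ (p.1 - p.2)⁻¹ * (F p.1 ^ 2 + H p.2 ^ 2)
        + logWeight p.1 * logWeight p.2 * (|F p.1| * |H p.2|) := by
        rw [add_mul]
        gcongr
    _ = _ := by ring

theorem potentialDefined {S : Set ℝ} {G u : ℝ → ℝ}
    (hG : LogAdmissible (volume.restrict S) fun x => G (u x)) : PotentialDefined S G u := by
  have hloc : ∀ n : ℕ, ∀ᵐ x : ℝ ∂volume.restrict S, |x| ≤ n →
      IntegrableOn (fun y => logKernel x y * G (u y)) S := by
    intro n
    have hone : LogAdmissible (volume.restrict S) ((Icc (-(n : ℝ)) n).indicator 1) :=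
      of_bounded_support (R := n) Measure.restrict_le_self
        ((memLp_indicator_const 2 measurableSet_Icc (1 : ℝ)
          (Or.inr measure_Icc_lt_top.ne)).restrict S)
        (ae_of_all _ fun x hx =>
          indicator_of_notMem (fun h : x ∈ Icc _ _ => hx.not_ge (abs_le.2 h)) _)
    filter_upwards [(hone.integrable_prod hG).prod_right_ae] with x hx hxn
    simpa [IntegrableOn, indicator_of_mem (show x ∈ Icc (-(n : ℝ)) n from abs_le.1 hxn)] using hx
  filter_upwards [ae_all_iff.2 hloc] with x hx
  obtain ⟨n, hn⟩ := exists_nat_ge |x|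
  exact hx n hn

end LogAdmissible

theorem MemHHalf.logAdmissible_of_le_exp {P : ℝ → ℝ} (hP : MemHHalf P) {S : Set ℝ} {F : ℝ → ℝ}
    {C β R : ℝ} (hβ : 0 ≤ β) (hF : AEStronglyMeasurable F (volume.restrict S))
    (hle : ∀ x, |F x| ≤ C * Real.exp (β * P x ^ 2))
    (h0 : ∀ᵐ x ∂volume.restrict S, R < |x| → F x = 0) :
    LogAdmissible (volume.restrict S) F := by
  refine .of_bounded_support Measure.restrict_le_self ?_ h0
  have hexp : IntegrableOn (fun x => Real.exp (2 * β * P x ^ 2)) (Icc (-R) R) := by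
    refine ⟨(Real.continuous_exp.comp_aestronglyMeasurable
      ((hP.1.aestronglyMeasurable.pow 2).const_mul (2 * β))).restrict,
      (hasFiniteIntegral_iff_ofReal (ae_of_all _ fun x => (Real.exp_pos _).le)).2 ?_⟩
    exact hP.setLIntegral_exp_lt_top (by positivity) measure_Icc_lt_top
  refine (memLp_two_iff_integrable_sq hF).2
    (((hexp.integrable_indicator measurableSet_Icc).const_mul (C ^ 2)).restrict.mono' (hF.pow 2) ?_)
  filter_upwards [h0] with x hx
  simp only [indicator_apply, mem_Icc, ← abs_le, norm_pow, Real.norm_eq_abs]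
  split_ifs with hxR
  · calc |F x| ^ 2 ≤ (C * Real.exp (β * P x ^ 2)) ^ 2 :=
          pow_le_pow_left₀ (abs_nonneg _) (hle x) 2
      _ = C ^ 2 * Real.exp (2 * β * P x ^ 2) := by
          rw [mul_pow, ← Real.exp_nat_mul]; push_cast; ring_nf
  · simp [hx (not_le.1 hxR)]

/-- The bilinear form of the logarithmic energy. -/
def logForm (S : Set ℝ) (F H : ℝ → ℝ) : ℝ :=
  ∫ p : ℝ × ℝ, logKernel p.1 p.2 * F p.1 * H p.2 ∂((volume.restrict S).prod (volume.restrict S))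

theorem logForm_comm (S : Set ℝ) (F H : ℝ → ℝ) : logForm S F H = logForm S H F := by
  unfold logForm
  rw [← integral_prod_swap]
  refine integral_congr_ae (ae_of_all _ fun p => ?_)
  simp only [Prod.fst_swap, Prod.snd_swap]
  rw [logKernel_comm]; ring

theorem logForm_const_mul_right (S : Set ℝ) (F H : ℝ → ℝ) (c : ℝ) :
    logForm S F (fun x => c * H x) = c * logForm S F H := by
  unfold logForm
  rw [← integral_const_mul]
  exact integral_congr_ae (ae_of_all _ fun p => mul_left_comm _ _ _)

section LogForm

variable {S : Set ℝ} {F H H' : ℝ → ℝ}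

theorem logForm_add_right (hF : LogAdmissible (volume.restrict S) F)
    (hH : LogAdmissible (volume.restrict S) H) (hH' : LogAdmissible (volume.restrict S) H') :
    logForm S F (fun x => H x + H' x) = logForm S F H + logForm S F H' := by
  unfold logForm
  rw [← integral_add (hF.integrable_prod hH) (hF.integrable_prod hH')]
  exact integral_congr_ae (ae_of_all _ fun p => mul_add _ _ _)

theorem logForm_add_self (hF : LogAdmissible (volume.restrict S) F)
    (hH : LogAdmissible (volume.restrict S) H) :
    logForm S (fun x => F x + H x) (fun x => F x + H x)
      = logForm S F F + 2 * logForm S F H + logForm S H H := by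
  rw [logForm_add_right (hF.add hH) hF hH, logForm_comm S _ F, logForm_comm S _ H,
    logForm_add_right hF hF hH, logForm_add_right hH hF hH, logForm_comm S H F]
  ring

theorem LogAdmissible.integrable_potential_mul (hF : LogAdmissible (volume.restrict S) F)
    (hH : LogAdmissible (volume.restrict S) H) :
    IntegrableOn (fun x => (∫ y in S, logKernel x y * F y) * H x) S := by
  refine (hH.integrable_prod hF).integral_prod_left.congr (ae_of_all _ fun x => ?_)
  simp only [← integral_mul_const, mul_right_comm]

theorem logForm_eq_integral_potential (hF : LogAdmissible (volume.restrict S) F)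
    (hH : LogAdmissible (volume.restrict S) H) :
    logForm S F H = ∫ x in S, (∫ y in S, logKernel x y * F y) * H x := by
  rw [logForm_comm, logForm, integral_prod _ (hH.integrable_prod hF)]
  simp only [← integral_mul_const, mul_right_comm]

end LogForm

theorem ofReal_log_mul {r a : ℝ} (ha : 0 ≤ a) :
    ENNReal.ofReal (Real.log r * a) = ENNReal.ofReal (log⁺ r * a) := by
  rw [Real.posLog_apply, max_mul_of_nonneg _ _ ha, zero_mul, ENNReal.ofReal_max,
    ENNReal.ofReal_zero, max_eq_right zero_le]

theorem energy_eq_logForm {S : Set ℝ} {G w : ℝ → ℝ} (hG : ∀ t, 0 ≤ G t)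
    (hw : LogAdmissible (volume.restrict S) fun x => G (w x)) :
    energy S G w = (logForm S (fun x => G (w x)) (fun x => G (w x)) : ℝ) := by
  have hint := hw.integrable_prod hw
  have hpos : energyPos S G w = ∫⁻ p : ℝ × ℝ,
      ENNReal.ofReal (logKernel p.1 p.2 * G (w p.1) * G (w p.2))
        ∂((volume.restrict S).prod (volume.restrict S)) := by
    rw [lintegral_prod _ hint.aestronglyMeasurable.aemeasurable.ennreal_ofReal]
    simp only [energyPos, logKernel, mul_assoc, ofReal_log_mul (mul_nonneg (hG _) (hG _))]
  have hneg : energyNeg S G w = ∫⁻ p : ℝ × ℝ,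
      ENNReal.ofReal (-(logKernel p.1 p.2 * G (w p.1) * G (w p.2)))
        ∂((volume.restrict S).prod (volume.restrict S)) := by
    rw [lintegral_prod (f := fun p : ℝ × ℝ => ENNReal.ofReal
      (-(logKernel p.1 p.2 * G (w p.1) * G (w p.2))))
      hint.aestronglyMeasurable.aemeasurable.neg.ennreal_ofReal]
    simp only [energyNeg, logKernel, mul_assoc, one_div, Real.log_inv, neg_mul, neg_neg,
      ofReal_log_mul (mul_nonneg (hG _) (hG _))]
  have hfin := ((hasFiniteIntegral_iff_norm _).1 hint.hasFiniteIntegral).ne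
  have hpos_fin : energyPos S G w ≠ ∞ := by
    rw [hpos]
    exact ne_top_of_le_ne_top hfin
      (lintegral_mono fun p => ENNReal.ofReal_le_ofReal (le_abs_self _))
  have hneg_fin : energyNeg S G w ≠ ∞ := by
    rw [hneg]
    exact ne_top_of_le_ne_top hfin
      (lintegral_mono fun p => ENNReal.ofReal_le_ofReal (neg_le_abs _))
  rw [energy, ← EReal.coe_ennreal_toReal hpos_fin, ← EReal.coe_ennreal_toReal hneg_fin,
    ← EReal.coe_sub, logForm, integral_eq_lintegral_pos_part_sub_lintegral_neg_part hint,
    hpos, hneg]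

theorem tendsto_logForm {ι : Type*} {l : Filter ι} [l.IsCountablyGenerated] {S : Set ℝ}
    {M N : ℝ → ℝ} {F H : ι → ℝ → ℝ} {F₀ H₀ : ℝ → ℝ}
    (hM : LogAdmissible (volume.restrict S) M) (hN : LogAdmissible (volume.restrict S) N)
    (hFm : ∀ i, AEStronglyMeasurable (F i) (volume.restrict S))
    (hHm : ∀ i, AEStronglyMeasurable (H i) (volume.restrict S))
    (hFM : ∀ᶠ i in l, ∀ x, |F i x| ≤ M x) (hHN : ∀ᶠ i in l, ∀ x, |H i x| ≤ N x)
    (hF : ∀ x, Tendsto (fun i => F i x) l (𝓝 (F₀ x)))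
    (hH : ∀ x, Tendsto (fun i => H i x) l (𝓝 (H₀ x))) :
    Tendsto (fun i => logForm S (F i) (H i)) l (𝓝 (logForm S F₀ H₀)) := by
  refine tendsto_integral_filter_of_dominated_convergence
    (fun p => |logKernel p.1 p.2 * M p.1 * N p.2|)
    (.of_forall fun i => (measurable_logKernel.aestronglyMeasurable.mul (hFm i).comp_fst).mul
      (hHm i).comp_snd) ?_ (hM.integrable_prod hN).abs
    (ae_of_all _ fun p => ((hF p.1).const_mul _).mul (hH p.2))
  filter_upwards [hFM, hHN] with i hFi hHi
  refine ae_of_all _ fun p => ?_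
  rw [norm_mul, norm_mul, abs_mul, abs_mul]
  gcongr
  · rfl
  · exact (hFi p.1).trans (le_abs_self _)
  · exact (hHi p.2).trans (le_abs_self _)

/-! ### The nonlinearity -/

/-- `G` is continuously differentiable and its derivative is bounded by `c exp (α t²)`. -/
structure GrowthBound (G : ℝ → ℝ) (c α : ℝ) : Prop where
  contDiff : ContDiff ℝ 1 G
  exponent_nonneg : 0 ≤ α
  abs_deriv_le : ∀ t, |deriv G t| ≤ c * Real.exp (α * t ^ 2)

namespace CondA

variable {G : ℝ → ℝ}

theorem deriv_neg (hA : CondA G) (t : ℝ) : deriv G (-t) = -deriv G t := by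
  have h := deriv_comp_neg G t
  rw [show (fun s => G (-s)) = G from funext hA.even] at h
  rw [h, neg_neg]

theorem deriv_zero (hA : CondA G) : deriv G 0 = 0 := by
  have h := hA.deriv_neg 0
  rw [neg_zero] at h
  linarith

theorem deriv_nonneg (hA : CondA G) {t : ℝ} (ht : 0 ≤ t) : 0 ≤ deriv G t := by
  rcases ht.eq_or_lt with rfl | ht
  · exact hA.deriv_zero.ge
  · have h := (hA.strictMonoOn.monotoneOn).derivWithin_nonneg (x := t)
    rwa [derivWithin_of_mem_nhds (Ici_mem_nhds ht)] at h

theorem lt_of_abs_lt (hA : CondA G) {s t : ℝ} (h : |s| < |t|) : G s < G t := by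
  have habs : ∀ r, G |r| = G r := fun r => by
    rcases abs_choice r with hr | hr <;> rw [hr]
    exact hA.even r
  rw [← habs s, ← habs t]
  exact hA.strictMonoOn (abs_nonneg s) (abs_nonneg t) h

theorem growthBound (hA : CondA G) (hG : ContDiff ℝ 1 G) {c α : ℝ} (hα : 0 ≤ α)
    (h : ∀ t, deriv G t ≤ c * Real.exp (α * t ^ 2)) : GrowthBound G c α := by
  refine ⟨hG, hα, fun t => abs_le.2 ⟨?_, h t⟩⟩
  have hneg := h (-t)
  rw [hA.deriv_neg, neg_sq] at hneg
  linarith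

theorem interior_critical (hA : CondA G) (hG : Differentiable ℝ G) :
    interior {t | deriv G t = 0} = ∅ := by
  refine eq_empty_iff_forall_notMem.2 fun t ht => ?_
  obtain ⟨ε, hε, hball⟩ := Metric.isOpen_iff.1 isOpen_interior t ht
  have hconst : ∀ s, |s - t| < ε → G s = G t := fun s hs =>
    Metric.isOpen_ball.is_const_of_deriv_eq_zero (convex_ball t ε).isPreconnected
      hG.differentiableOn (hball.trans interior_subset)
      (by rwa [Metric.mem_ball, Real.dist_eq]) (Metric.mem_ball_self hε)
  rcases le_or_gt 0 t with h0 | h0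
  · refine (hA.lt_of_abs_lt (s := t) (t := t + ε / 2) ?_).ne' (hconst _ ?_)
    · rw [abs_of_nonneg h0, abs_of_nonneg (by positivity)]; linarith
    · rw [add_sub_cancel_left, abs_of_pos (by positivity)]; linarith
  · refine (hA.lt_of_abs_lt (s := t) (t := t - ε / 2) ?_).ne' (hconst _ ?_)
    · rw [abs_of_neg h0, abs_of_neg (by linarith)]; linarith
    · rw [sub_sub_cancel_left, abs_neg, abs_of_pos (by positivity)]; linarith

end CondA

namespace GrowthBound

variable {G : ℝ → ℝ} {c α : ℝ}

theorem differentiable (hG : GrowthBound G c α) : Differentiable ℝ G :=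
  hG.contDiff.differentiable one_ne_zero

theorem continuous_deriv (hG : GrowthBound G c α) : Continuous (deriv G) :=
  hG.contDiff.continuous_deriv le_rfl

theorem const_nonneg (hG : GrowthBound G c α) : 0 ≤ c := by
  simpa using (abs_nonneg _).trans (hG.abs_deriv_le 0)

theorem abs_deriv_le_of_abs_le (hG : GrowthBound G c α) {t P : ℝ} (ht : |t| ≤ P) :
    |deriv G t| ≤ c * Real.exp (α * P ^ 2) := by
  have hc := hG.const_nonneg
  have hα := hG.exponent_nonneg
  have hsq : t ^ 2 ≤ P ^ 2 := sq_le_sq' (abs_le.1 ht).1 (abs_le.1 ht).2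
  exact (hG.abs_deriv_le t).trans (by gcongr)

theorem abs_sub_le (hG : GrowthBound G c α) {a b P : ℝ} (ha : |a| ≤ P) (hb : |b| ≤ P) :
    |G a - G b| ≤ c * Real.exp (α * P ^ 2) * |a - b| :=
  (convex_Icc (-P) P).norm_image_sub_le_of_norm_deriv_le (fun x _ => hG.differentiable x)
    (fun _ hx => hG.abs_deriv_le_of_abs_le (abs_le.2 hx)) (abs_le.1 hb) (abs_le.1 ha)

end GrowthBound

/-! ### Variations of the energy -/

/-- The test functions of the variational problem on `S`, i.e. the elements of `H₀^{1/2}(S)` of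
bounded support. -/
def testSpace (S : Set ℝ) : Submodule ℝ (ℝ → ℝ) where
  carrier := {φ | MemHHalfZero S φ ∧ HasBoundedSupport φ}
  zero_mem' := ⟨⟨hHalf.zero_mem, ae_of_all _ fun _ _ => rfl⟩, 0, ae_of_all _ fun _ _ => rfl⟩
  add_mem' := by
    rintro φ ψ ⟨⟨hφ, hφS⟩, R, hR⟩ ⟨⟨hψ, hψS⟩, R', hR'⟩
    refine ⟨⟨hHalf.add_mem hφ hψ, ?_⟩, max R R', ?_⟩
    · filter_upwards [hφS, hψS] with x hφx hψx hx
      rw [Pi.add_apply, hφx hx, hψx hx, add_zero]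
    · filter_upwards [hR, hR'] with x hφx hψx hx
      rw [Pi.add_apply, hφx ((le_max_left _ _).trans_lt hx), hψx ((le_max_right _ _).trans_lt hx),
        add_zero]
  smul_mem' := by
    rintro a φ ⟨⟨hφ, hφS⟩, R, hR⟩
    refine ⟨⟨hHalf.smul_mem a hφ, ?_⟩, R, ?_⟩
    · filter_upwards [hφS] with x hφx hx
      rw [Pi.smul_apply, hφx hx, smul_zero]
    · filter_upwards [hR] with x hφx hx
      rw [Pi.smul_apply, hφx hx, smul_zero]

theorem testSpace_le_hHalf (S : Set ℝ) : testSpace S ≤ hHalf := fun _ hφ => hφ.1.1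

theorem abs_mem_testSpace {S : Set ℝ} (φ : testSpace S) : (fun x => |φ.1 x|) ∈ testSpace S := by
  obtain ⟨φ, ⟨hφ, hφS⟩, R, hR⟩ := φ
  refine ⟨⟨hφ.lipschitz_comp lipschitzWith_one_norm abs_zero, ?_⟩, R, ?_⟩
  · filter_upwards [hφS] with x hφx hx
    rw [hφx hx, abs_zero]
  · filter_upwards [hR] with x hφx hx
    rw [hφx hx, abs_zero]

/-- The curve `t ↦ t φ + t² ψ` of variations, with velocity `φ` at `t = 0`; the second-order
term `ψ` corrects the constraint. -/
def curve {E : Type*} [AddCommGroup E] [Module ℝ E] (φ ψ : E) (t : ℝ) : E := t • φ + t ^ 2 • ψ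

/-- The increment `G (u + w) - G u`. -/
def increment (G u w : ℝ → ℝ) (x : ℝ) : ℝ := G (u x + w x) - G (u x)

/-- An admissible bound for `increment G u w / s` whenever `|w| ≤ s |χ|` and `0 ≤ s ≤ 1`. -/
def majorant (c α : ℝ) (u χ : ℝ → ℝ) (x : ℝ) : ℝ :=
  |χ x| * (c * Real.exp (α * (|u x| + |χ x|) ^ 2))

/-- Half of the derivative of the energy at `u` in the direction `φ`. -/
def energyDeriv (S : Set ℝ) (G u φ : ℝ → ℝ) : ℝ :=
  logForm S (fun x => G (u x)) (fun x => deriv G (u x) * φ x)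

section Variation

variable {S : Set ℝ} {G u : ℝ → ℝ} {c α : ℝ}

theorem abs_curve_le (φ ψ : testSpace S) {t : ℝ} (h0 : 0 ≤ t) (h1 : t ≤ 1) (x : ℝ) :
    |(curve φ ψ t).1 x| ≤ t * (|φ.1 x| + |ψ.1 x|) :=
  calc |t * φ.1 x + t ^ 2 * ψ.1 x| ≤ t * |φ.1 x| + t ^ 2 * |ψ.1 x| := by
        refine (abs_add_le _ _).trans_eq ?_
        rw [abs_mul, abs_mul, abs_of_nonneg h0, abs_of_nonneg (pow_nonneg h0 2)]
    _ ≤ t * |φ.1 x| + t * |ψ.1 x| := by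
        gcongr
        exact pow_le_of_le_one h0 h1 two_ne_zero
    _ = t * (|φ.1 x| + |ψ.1 x|) := (mul_add _ _ _).symm

namespace GrowthBound

theorem abs_increment_le (hG : GrowthBound G c α) {w χ : ℝ → ℝ} {s x : ℝ} (h1 : s ≤ 1)
    (hw : |w x| ≤ s * |χ x|) :
    |increment G u w x| ≤ s * majorant c α u χ x := by
  have hc := hG.const_nonneg
  have hw' : |w x| ≤ |χ x| := hw.trans (mul_le_of_le_one_left (abs_nonneg _) h1)
  calc |increment G u w x|
      ≤ c * Real.exp (α * (|u x| + |χ x|) ^ 2) * |u x + w x - u x| :=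
        hG.abs_sub_le ((abs_add_le _ _).trans (by gcongr))
          (le_add_of_nonneg_right (abs_nonneg _))
    _ ≤ c * Real.exp (α * (|u x| + |χ x|) ^ 2) * (s * |χ x|) := by
        rw [add_sub_cancel_left]; gcongr
    _ = s * majorant c α u χ x := by rw [majorant]; ring

theorem tendsto_inv_mul_increment (hG : GrowthBound G c α) (u : ℝ → ℝ) (φ ψ : testSpace S)
    (x : ℝ) : Tendsto (fun t => t⁻¹ * increment G u (curve φ ψ t).1 x) (𝓝[>] 0)
      (𝓝 (deriv G (u x) * φ.1 x)) := by
  have hcurve : HasDerivAt (fun t : ℝ => u x + (t * φ.1 x + t ^ 2 * ψ.1 x)) (φ.1 x) 0 := by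
    have h := ((hasDerivAt_id (0 : ℝ)).mul_const (φ.1 x)).add
      ((hasDerivAt_pow 2 (0 : ℝ)).mul_const (ψ.1 x))
    simpa using h.const_add (u x)
  have hG' : HasDerivAt G (deriv G (u x)) (u x + (0 * φ.1 x + 0 ^ 2 * ψ.1 x)) := by
    simpa using (hG.differentiable (u x)).hasDerivAt
  refine ((hG'.comp (0 : ℝ) hcurve).tendsto_slope_zero_right).congr fun t => ?_
  simp [curve, increment]

theorem logAdmissible_majorant (hG : GrowthBound G c α) (hu : MemHHalf u) {χ : ℝ → ℝ}
    (hχ : χ ∈ testSpace S) : LogAdmissible (volume.restrict S) (majorant c α u χ) := by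
  have hc := hG.const_nonneg
  have hα := hG.exponent_nonneg
  have habs {v : ℝ → ℝ} (hv : MemHHalf v) : MemHHalf fun x => |v x| :=
    hv.lipschitz_comp lipschitzWith_one_norm abs_zero
  obtain ⟨⟨hχ, -⟩, R, hR⟩ := hχ
  have hP : MemHHalf fun x => |u x| + |χ x| := hHalf.add_mem (habs hu) (habs hχ)
  refine hP.logAdmissible_of_le_exp (C := c) (β := 1 + α) (R := R) (by positivity) ?_
    (fun x => ?_) (ae_restrict_of_ae ?_)
  · exact ((habs hχ).1.aestronglyMeasurable.mul ((Real.continuous_exp.comp_aestronglyMeasurable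
      ((hP.1.aestronglyMeasurable.pow 2).const_mul α)).const_mul c)).restrict
  · rw [majorant, abs_of_nonneg (by positivity)]
    set P := |u x| + |χ x|
    have hχP : |χ x| ≤ P := le_add_of_nonneg_left (abs_nonneg _)
    have hexp : |χ x| ≤ Real.exp (P ^ 2) := by
      nlinarith [Real.add_one_le_exp (P ^ 2), sq_nonneg (P - 1)]
    calc |χ x| * (c * Real.exp (α * P ^ 2)) ≤ Real.exp (P ^ 2) * (c * Real.exp (α * P ^ 2)) := by
          gcongr
      _ = c * Real.exp ((1 + α) * P ^ 2) := by rw [add_mul, one_mul, Real.exp_add]; ring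
  · filter_upwards [hR] with x hx hRx
    rw [majorant, hx hRx, abs_zero, zero_mul]

theorem aestronglyMeasurable_increment (hG : GrowthBound G c α) (hu : MemHHalf u)
    (w : testSpace S) : AEStronglyMeasurable (increment G u w.1) (volume.restrict S) := by
  have hcont := hG.differentiable.continuous
  have hum := hu.1.aestronglyMeasurable
  have hwm := w.2.1.1.1.aestronglyMeasurable
  exact ((hcont.comp_aestronglyMeasurable (hum.add hwm)).sub
    (hcont.comp_aestronglyMeasurable hum)).restrict

theorem logAdmissible_increment (hG : GrowthBound G c α) (hu : MemHHalf u) (w : testSpace S) :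
    LogAdmissible (volume.restrict S) (increment G u w.1) := by
  refine (hG.logAdmissible_majorant hu w.2).mono (hG.aestronglyMeasurable_increment hu w)
    (ae_of_all _ fun x => ?_)
  have h := hG.abs_increment_le (u := u) (χ := w.1) le_rfl (one_mul |w.1 x|).ge
  rw [one_mul] at h
  exact h.trans (le_abs_self _)

theorem logAdmissible_deriv_mul (hG : GrowthBound G c α) (hu : MemHHalf u) (φ : testSpace S) :
    LogAdmissible (volume.restrict S) fun x => deriv G (u x) * φ.1 x := by
  refine (hG.logAdmissible_majorant hu φ.2).mono
    ((hG.continuous_deriv.comp_aestronglyMeasurable hu.1.aestronglyMeasurable).mul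
      φ.2.1.1.1.aestronglyMeasurable).restrict (ae_of_all _ fun x => ?_)
  refine le_trans ?_ (le_abs_self _)
  rw [abs_mul, mul_comm, majorant]
  gcongr
  exact hG.abs_deriv_le_of_abs_le (le_add_of_nonneg_right (abs_nonneg _))

theorem eventually_abs_inv_mul_increment_le (hG : GrowthBound G c α) (u : ℝ → ℝ)
    (φ ψ : testSpace S) : ∀ᶠ t in 𝓝[>] (0 : ℝ), ∀ x,
      |t⁻¹ * increment G u (curve φ ψ t).1 x|
        ≤ majorant c α u (fun x => |φ.1 x| + |ψ.1 x|) x := by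
  filter_upwards [Ioc_mem_nhdsGT one_pos] with t ht x
  rw [abs_mul, abs_inv, abs_of_pos ht.1, inv_mul_le_iff₀ ht.1]
  refine hG.abs_increment_le ht.2 ((abs_curve_le φ ψ ht.1.le ht.2 x).trans_eq ?_)
  rw [abs_of_nonneg (add_nonneg (abs_nonneg (φ.1 x)) (abs_nonneg (ψ.1 x)))]

theorem tendsto_logForm_increment (hG : GrowthBound G c α) (hu : MemHHalf u) {F : ℝ → ℝ}
    (hF : LogAdmissible (volume.restrict S) F) (φ ψ : testSpace S) :
    Tendsto (fun t => t⁻¹ * logForm S F (increment G u (curve φ ψ t).1)) (𝓝[>] 0)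
      (𝓝 (logForm S F fun x => deriv G (u x) * φ.1 x)) := by
  simp only [← logForm_const_mul_right]
  exact tendsto_logForm hF.abs
    (hG.logAdmissible_majorant hu ((testSpace S).add_mem (abs_mem_testSpace φ)
      (abs_mem_testSpace ψ)))
    (fun _ => hF.memLp.aestronglyMeasurable)
    (fun t => (hG.aestronglyMeasurable_increment hu (curve φ ψ t)).const_mul _)
    (.of_forall fun _ _ => le_rfl) (hG.eventually_abs_inv_mul_increment_le u φ ψ)
    (fun _ => tendsto_const_nhds) (hG.tendsto_inv_mul_increment u φ ψ)

theorem tendsto_logForm_increment_self (hG : GrowthBound G c α) (hu : MemHHalf u)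
    (φ ψ : testSpace S) :
    Tendsto (fun t => (t ^ 2)⁻¹ * logForm S (increment G u (curve φ ψ t).1)
        (increment G u (curve φ ψ t).1)) (𝓝[>] 0)
      (𝓝 (logForm S (fun x => deriv G (u x) * φ.1 x) fun x => deriv G (u x) * φ.1 x)) := by
  have hM := hG.logAdmissible_majorant hu ((testSpace S).add_mem (abs_mem_testSpace φ)
    (abs_mem_testSpace ψ))
  have hm (t : ℝ) := (hG.aestronglyMeasurable_increment hu (curve φ ψ t)).const_mul t⁻¹
  have hle := hG.eventually_abs_inv_mul_increment_le u φ ψ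
  have hlim := hG.tendsto_inv_mul_increment u φ ψ
  refine (tendsto_logForm hM hM hm hm hle hle hlim hlim).congr fun t => ?_
  rw [logForm_const_mul_right, logForm_comm, logForm_const_mul_right, ← mul_assoc, sq, mul_inv]

theorem energyDeriv_eq_integral (hG : GrowthBound G c α) (hu : MemHHalf u)
    (hGu : LogAdmissible (volume.restrict S) fun x => G (u x)) (φ : testSpace S) :
    energyDeriv S G u φ.1 = ∫ x in S, logPotential S G u x * deriv G (u x) * φ.1 x := by
  simp only [mul_assoc]
  exact logForm_eq_integral_potential hGu (hG.logAdmissible_deriv_mul hu φ)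

theorem integrable_potential_deriv (hG : GrowthBound G c α) (hu : MemHHalf u)
    (hGu : LogAdmissible (volume.restrict S) fun x => G (u x)) (φ : testSpace S) :
    IntegrableOn (fun x => logPotential S G u x * deriv G (u x) * φ.1 x) S := by
  simp only [mul_assoc]
  exact hGu.integrable_potential_mul (hG.logAdmissible_deriv_mul hu φ)

theorem isLinearMap_energyDeriv (hG : GrowthBound G c α) (hu : MemHHalf u)
    (hGu : LogAdmissible (volume.restrict S) fun x => G (u x)) :
    IsLinearMap ℝ fun φ : testSpace S => energyDeriv S G u φ.1 where
  map_add φ ψ := by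
    rw [energyDeriv, energyDeriv, energyDeriv, ← logForm_add_right hGu
      (hG.logAdmissible_deriv_mul hu φ) (hG.logAdmissible_deriv_mul hu ψ)]
    simp only [Submodule.coe_add, Pi.add_apply, mul_add]
  map_smul a φ := by
    rw [energyDeriv, energyDeriv, smul_eq_mul, ← logForm_const_mul_right]
    simp only [Submodule.coe_smul, Pi.smul_apply, smul_eq_mul, mul_left_comm _ a]

theorem energy_lt_energy_add_iff (hG : GrowthBound G c α) (h0 : ∀ t, 0 ≤ G t) (hu : MemHHalf u)
    (hGu : LogAdmissible (volume.restrict S) fun x => G (u x)) (w : testSpace S) :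
    energy S G u < energy S G (u + w.1) ↔
      0 < 2 * logForm S (fun x => G (u x)) (increment G u w.1)
        + logForm S (increment G u w.1) (increment G u w.1) := by
  have hw := hG.logAdmissible_increment hu w
  have hadd : (fun x => G ((u + w.1) x)) = fun x => G (u x) + increment G u w.1 x := by
    ext x; simp [increment]
  rw [energy_eq_logForm h0 hGu, energy_eq_logForm h0 (hadd ▸ hGu.add hw), hadd,
    logForm_add_self hGu hw, EReal.coe_lt_coe_iff, add_assoc, lt_add_iff_pos_right]

theorem eventually_energy_lt_of_energyDeriv_pos (hG : GrowthBound G c α) (h0 : ∀ t, 0 ≤ G t)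
    (hu : MemHHalf u) (hGu : LogAdmissible (volume.restrict S) fun x => G (u x))
    {φ : testSpace S} (hφ : 0 < energyDeriv S G u φ.1) (ψ : testSpace S) :
    ∀ᶠ t in 𝓝[>] (0 : ℝ), energy S G u < energy S G (u + (curve φ ψ t).1) := by
  have hid : Tendsto (fun t : ℝ => t) (𝓝[>] 0) (𝓝 0) := nhdsWithin_le_nhds
  have hlim := ((hG.tendsto_logForm_increment hu hGu φ ψ).const_mul 2).add
    (hid.mul (hG.tendsto_logForm_increment_self hu φ ψ))
  rw [zero_mul, add_zero] at hlim
  filter_upwards [hlim.eventually_const_lt (mul_pos two_pos hφ), self_mem_nhdsWithin]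
    with t ht (ht0 : 0 < t)
  rw [hG.energy_lt_energy_add_iff h0 hu hGu]
  refine pos_of_mul_pos_right (a := t⁻¹) (ht.trans_eq ?_) (inv_nonneg.2 ht0.le)
  field_simp

theorem eventually_energy_lt_of_potential_mul_eq_zero (hG : GrowthBound G c α)
    (h0 : ∀ t, 0 ≤ G t) (hu : MemHHalf u)
    (hGu : LogAdmissible (volume.restrict S) fun x => G (u x)) {φ ψ : testSpace S}
    (hφ : ∀ᵐ x ∂volume.restrict S, logPotential S G u x * φ.1 x = 0)
    (hφφ : 0 < logForm S (fun x => deriv G (u x) * φ.1 x) fun x => deriv G (u x) * φ.1 x)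
    (hψ : energyDeriv S G u ψ.1 = 0) :
    ∀ᶠ t in 𝓝[>] (0 : ℝ), energy S G u < energy S G (u + (curve φ ψ t).1) := by
  have hcongr (t : ℝ) : logForm S (fun x => G (u x)) (increment G u (curve φ ψ t).1)
      = logForm S (fun x => G (u x)) (increment G u (curve ψ 0 (t ^ 2)).1) := by
    rw [logForm_eq_integral_potential hGu (hG.logAdmissible_increment hu _),
      logForm_eq_integral_potential hGu (hG.logAdmissible_increment hu _)]
    refine integral_congr_ae ?_
    filter_upwards [hφ] with x hx
    rcases mul_eq_zero.1 hx with hx | hx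
    · exact (mul_eq_zero_of_left hx _).trans (mul_eq_zero_of_left hx _).symm
    · simp [increment, curve, hx]
  have hsq : Tendsto (fun t : ℝ => t ^ 2) (𝓝[>] 0) (𝓝[>] 0) :=
    tendsto_nhdsWithin_iff.2 ⟨(Continuous.tendsto' (by fun_prop) _ _ (by simp)).mono_left
      nhdsWithin_le_nhds, by
        filter_upwards [self_mem_nhdsWithin] with t (ht : 0 < t) using pow_pos ht 2⟩
  have hlim := (((hG.tendsto_logForm_increment hu hGu ψ 0).comp hsq).const_mul 2).add
    (hG.tendsto_logForm_increment_self hu φ ψ)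
  rw [show logForm S (fun x => G (u x)) (fun x => deriv G (u x) * ψ.1 x) = 0 from hψ,
    mul_zero, zero_add] at hlim
  filter_upwards [hlim.eventually_const_lt hφφ] with t ht
  rw [hG.energy_lt_energy_add_iff h0 hu hGu, hcongr]
  refine pos_of_mul_pos_right (a := (t ^ 2)⁻¹) (ht.trans_eq ?_) (by positivity)
  simp only [Function.comp_apply]
  ring

end GrowthBound

end Variation

/-! ### The multiplier -/

section Curve

variable {E : Type*} [AddCommGroup E] [Module ℝ E]

theorem exists_pos_smul_eq_of_neg_imp_nonpos {q L : E →ₗ[ℝ] ℝ} (hq : q ≠ 0) (hL : L ≠ 0)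
    (h : ∀ v, q v < 0 → L v ≤ 0) : ∃ θ : ℝ, 0 < θ ∧ q = θ • L := by
  obtain ⟨v₀, hv₀⟩ : ∃ v, q v = -1 := LinearMap.surjective hq (-1)
  have hker (v : E) (hv : q v = 0) : L v = 0 := by
    by_contra hLv
    have h1 := h (v₀ + ((1 - L v₀) / L v) • v) (by simp [hv, hv₀])
    rw [map_add, map_smul, smul_eq_mul, div_mul_cancel₀ _ hLv] at h1
    linarith
  have hLq (v : E) : L v = -L v₀ * q v := by
    have h1 := hker (v + q v • v₀) (by simp [hv₀])
    rw [map_add, map_smul, smul_eq_mul] at h1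
    linarith
  have hne : L v₀ ≠ 0 := fun h0 => hL (LinearMap.ext fun v => by simp [hLq v, h0])
  have hneg : L v₀ < 0 := lt_of_le_of_ne (h v₀ (by rw [hv₀]; norm_num)) hne
  refine ⟨(-L v₀)⁻¹, inv_pos.2 (neg_pos.2 hneg), LinearMap.ext fun v => ?_⟩
  rw [LinearMap.smul_apply, smul_eq_mul, hLq v, inv_mul_cancel_left₀ (neg_ne_zero.2 hne)]

theorem map_curve {F : Type*} [AddCommGroup F] [Module ℝ F] (f : E →ₗ[ℝ] F) (φ ψ : E) (t : ℝ) :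
    f (curve φ ψ t) = curve (f φ) (f ψ) t := by
  simp only [curve, map_add, map_smul]

variable {B : LinearMap.BilinForm ℝ E} {u φ ψ : E}

theorem bilinForm_add_curve (hB : B.IsSymm) (u φ ψ : E) (t : ℝ) :
    B (u + curve φ ψ t) (u + curve φ ψ t)
      = B u u + t * (2 * B u φ + t * (2 * B u ψ + B φ φ + t * (2 * B φ ψ + t * B ψ ψ))) := by
  simp only [curve, map_add, map_smul, LinearMap.add_apply, LinearMap.smul_apply, smul_eq_mul,
    hB.eq φ u, hB.eq ψ u, hB.eq ψ φ]
  ring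

theorem eventually_bilinForm_le_one_of_lt_one (hB : B.IsSymm) (hu : B u u < 1) (φ ψ : E) :
    ∀ᶠ t in 𝓝[>] (0 : ℝ), B (u + curve φ ψ t) (u + curve φ ψ t) ≤ 1 := by
  simp only [bilinForm_add_curve hB]
  exact ((Continuous.tendsto' (by fun_prop) (0 : ℝ) _ (by ring)).mono_left
    nhdsWithin_le_nhds).eventually_le_const hu

theorem eventually_bilinForm_le_one_of_neg (hB : B.IsSymm) (hu : B u u ≤ 1) (hφ : B u φ ≤ 0)
    (hψ : 2 * B u ψ + B φ φ < 0) :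
    ∀ᶠ t in 𝓝[>] (0 : ℝ), B (u + curve φ ψ t) (u + curve φ ψ t) ≤ 1 := by
  have hlim : Tendsto (fun t : ℝ => 2 * B u ψ + B φ φ + t * (2 * B φ ψ + t * B ψ ψ)) (𝓝[>] 0)
      (𝓝 (2 * B u ψ + B φ φ)) :=
    (Continuous.tendsto' (by fun_prop) _ _ (by ring)).mono_left nhdsWithin_le_nhds
  filter_upwards [hlim.eventually_lt_const hψ, self_mem_nhdsWithin] with t ht (ht0 : 0 < t)
  rw [bilinForm_add_curve hB]
  nlinarith [mul_neg_of_pos_of_neg ht0 ht]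

theorem exists_smul_bilinForm_lt {φ₀ : E} (hφ₀ : B u φ₀ < 0) (φ : E) :
    ∃ a : ℝ, 2 * B u (a • φ₀) + B φ φ < 0 := by
  refine ⟨(B φ φ + 1) / (-2 * B u φ₀), ?_⟩
  have : 2 * ((B φ φ + 1) / (-2 * B u φ₀) * B u φ₀) = -(B φ φ + 1) := by
    field_simp [hφ₀.ne]
  rw [map_smul, smul_eq_mul, this]
  linarith

end Curve

/-- The odd function with `criticalDist G t = dist (t, {G' = 0})` for `t ≥ 0`. -/
def criticalDist (G : ℝ → ℝ) (t : ℝ) : ℝ :=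
  Metric.infDist (max t 0) {s | deriv G s = 0} - Metric.infDist (max (-t) 0) {s | deriv G s = 0}

theorem lipschitzWith_criticalDist (G : ℝ → ℝ) : LipschitzWith 2 (criticalDist G) := by
  have hpos := (Metric.lipschitz_infDist_pt {s | deriv G s = 0}).comp
    (LipschitzWith.id.max_const (0 : ℝ))
  have hneg := (Metric.lipschitz_infDist_pt {s | deriv G s = 0}).comp
    ((LipschitzWith.id (α := ℝ)).neg.max_const 0)
  exact (hpos.sub hneg).weaken (by norm_num)

theorem criticalDist_neg (G : ℝ → ℝ) (t : ℝ) : criticalDist G (-t) = -criticalDist G t := by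
  rw [criticalDist, criticalDist, neg_neg, neg_sub]

theorem criticalDist_zero (G : ℝ → ℝ) : criticalDist G 0 = 0 := by
  rw [criticalDist, neg_zero, sub_self]

namespace CondA

variable {G : ℝ → ℝ}

theorem criticalDist_of_nonneg (hA : CondA G) {t : ℝ} (ht : 0 ≤ t) :
    criticalDist G t = Metric.infDist t {s | deriv G s = 0} := by
  rw [criticalDist, max_eq_left ht, max_eq_right (neg_nonpos.2 ht),
    Metric.infDist_zero_of_mem (show (0 : ℝ) ∈ {s | deriv G s = 0} from hA.deriv_zero), sub_zero]

theorem deriv_mul_criticalDist_nonneg (hA : CondA G) (t : ℝ) :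
    0 ≤ deriv G t * criticalDist G t := by
  have key {s : ℝ} (hs : 0 ≤ s) : 0 ≤ deriv G s * criticalDist G s :=
    mul_nonneg (hA.deriv_nonneg hs)
      (by rw [hA.criticalDist_of_nonneg hs]; exact Metric.infDist_nonneg)
  rcases le_total 0 t with ht | ht
  · exact key ht
  · simpa [hA.deriv_neg, criticalDist_neg] using key (neg_nonneg.2 ht)

theorem criticalDist_eq_zero_iff (hA : CondA G) (hG : Continuous (deriv G)) {t : ℝ} :
    criticalDist G t = 0 ↔ deriv G t = 0 := by
  have key {s : ℝ} (hs : 0 ≤ s) : criticalDist G s = 0 ↔ deriv G s = 0 := by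
    rw [hA.criticalDist_of_nonneg hs]
    exact ((isClosed_eq hG continuous_const).mem_iff_infDist_zero ⟨0, hA.deriv_zero⟩).symm
  rcases le_total 0 t with ht | ht
  · exact key ht
  · simpa [hA.deriv_neg, criticalDist_neg] using key (neg_nonneg.2 ht)

end CondA

theorem logKernel_pos {x y : ℝ} (hne : x ≠ y) (h : |x - y| < 1) : 0 < logKernel x y :=
  Real.log_pos ((one_lt_div (abs_pos.2 (sub_ne_zero.2 hne))).2 h)

theorem logForm_self_pos {S : Set ℝ} {F : ℝ → ℝ} (hF : LogAdmissible (volume.restrict S) F)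
    (hpos : ∀ x, 0 ≤ F x) (hsupp : ∀ x y, F x ≠ 0 → F y ≠ 0 → |x - y| < 1)
    (hne : ¬ F =ᵐ[volume.restrict S] 0) : 0 < logForm S F F := by
  have hnonneg (p : ℝ × ℝ) : 0 ≤ logKernel p.1 p.2 * F p.1 * F p.2 := by
    rcases eq_or_ne (F p.1) 0 with hx | hx
    · simp [hx]
    rcases eq_or_ne (F p.2) 0 with hy | hy
    · simp [hy]
    rcases eq_or_ne p.1 p.2 with hp | hp
    · simp [logKernel, hp]
    · exact mul_nonneg (mul_nonneg (logKernel_pos hp (hsupp _ _ hx hy)).le (hpos _)) (hpos _)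
  refine lt_of_le_of_ne (integral_nonneg hnonneg) fun h0 => hne ?_
  have hzero := Measure.ae_ae_of_ae_prod
    ((integral_eq_zero_iff_of_nonneg hnonneg (hF.integrable_prod hF)).1 h0.symm)
  have hfreq : ∃ᵐ x ∂volume.restrict S, F x ≠ 0 := fun h => hne (h.mono fun x => not_not.1)
  obtain ⟨x, hx, hxzero⟩ := (hfreq.and_eventually hzero).exists
  filter_upwards [hxzero, ae_restrict_of_ae (Measure.ae_ne volume x)] with y hy hyx
  by_contra hFy
  exact mul_ne_zero (mul_ne_zero (logKernel_pos (Ne.symm hyx) (hsupp x y hx hFy)).ne' hx) hFy hy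

section Multiplier

variable {S : Set ℝ} {G : ℝ → ℝ} {c α : ℝ}

/-- The test functions as elements of `H^{1/2}(ℝ)`. -/
def testInclusion (S : Set ℝ) : testSpace S →ₗ[ℝ] hHalf :=
  Submodule.inclusion (testSpace_le_hHalf S)

theorem contDiffBump_mul_criticalDist_mem_testSpace {u : ℝ → ℝ} (hu : MemHHalfZero S u) {x₀ : ℝ}
    (f : ContDiffBump x₀) : (fun x => f x * criticalDist G (u x)) ∈ testSpace S := by
  obtain ⟨K, hK⟩ := (f.contDiff (n := 1)).lipschitzWith_of_hasCompactSupport f.hasCompactSupport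
    one_ne_zero
  obtain ⟨R, hR⟩ := f.hasCompactSupport.isBounded.subset_closedBall 0
  refine ⟨⟨(hu.1.lipschitz_comp (lipschitzWith_criticalDist G) (criticalDist_zero G)).mul_lipschitz
    hK fun x => (abs_of_nonneg f.nonneg).trans_le f.le_one, ?_⟩, R, ae_of_all _ fun x hx => ?_⟩
  · filter_upwards [hu.2] with x hx hxS
    rw [hx hxS, criticalDist_zero, mul_zero]
  · have hfx : f x = 0 :=
      image_eq_zero_of_notMem_tsupport fun h => hx.not_ge (by simpa using hR h)
    exact mul_eq_zero_of_left hfx _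

/-- The function `φ` is `criticalDist G ∘ u` cut off to a short interval around a point every
neighbourhood of which meets `{G'(u) ≠ 0}` in positive measure. That set is not null because the
values of `u` do not skip intervals; on the short interval the kernel is positive. -/
theorem GrowthBound.exists_logForm_pos (hG : GrowthBound G c α) (hA : CondA G) {u : ℝ → ℝ}
    (hu : MemHHalfZero S u) (hS : MeasurableSet S) (hne : ¬ u =ᵐ[volume] 0) :
    ∃ φ : testSpace S, (∀ x, deriv G (u x) = 0 → φ.1 x = 0) ∧
      0 < logForm S (fun x => deriv G (u x) * φ.1 x) fun x => deriv G (u x) * φ.1 x := by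
  have hcrit (x : ℝ) := hA.criticalDist_eq_zero_iff hG.continuous_deriv (t := u x)
  have hW : volume {x | ¬ deriv G (u x) = 0} ≠ 0 := fun h => hne <|
    hu.1.ae_eq_zero_of_mem (isClosed_eq hG.continuous_deriv continuous_const)
      (hA.interior_critical hG.differentiable) (ae_iff.2 h)
  obtain ⟨x₀, -, hx₀⟩ := exists_mem_forall_mem_nhdsWithin_pos_measure hW
  let f : ContDiffBump x₀ := ⟨1 / 4, 1 / 2, by norm_num, by norm_num⟩
  let φ : testSpace S := ⟨_, contDiffBump_mul_criticalDist_mem_testSpace (G := G) hu f⟩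
  have hφ (x : ℝ) : φ.1 x = f x * criticalDist G (u x) := rfl
  have hsupp {x : ℝ} (hx : deriv G (u x) * φ.1 x ≠ 0) : |x - x₀| < 1 / 2 := by
    have : x ∈ Function.support f := left_ne_zero_of_mul (right_ne_zero_of_mul hx)
    rwa [f.support_eq, Metric.mem_ball, Real.dist_eq] at this
  refine ⟨φ, fun x hx => by rw [hφ, (hcrit x).2 hx, mul_zero],
    logForm_self_pos (hG.logAdmissible_deriv_mul hu.1 φ) (fun x => ?_) (fun x y hx hy => ?_)
      fun hzero => ?_⟩
  · rw [hφ, mul_left_comm]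
    exact mul_nonneg f.nonneg (hA.deriv_mul_criticalDist_nonneg (u x))
  · have htri := _root_.abs_sub_le x x₀ y
    rw [abs_sub_comm x₀ y] at htri
    linarith [hsupp hx, hsupp hy]
  · refine (hx₀ _ (inter_mem_nhdsWithin _ (Metric.ball_mem_nhds x₀ f.rOut_pos))).ne' ?_
    rw [EventuallyEq, ae_restrict_iff' hS] at hzero
    refine measure_mono_null ?_ (ae_iff.1 (hzero.and hu.2))
    rintro x ⟨hx, hxf⟩ ⟨hx0, hxS⟩
    have hxmem : x ∈ S := by
      by_contra h
      exact hx ((hcrit x).1 (by rw [hxS h, criticalDist_zero]))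
    rw [← f.support_eq] at hxf
    exact mul_ne_zero hx (mul_ne_zero hxf (mt (hcrit x).1 hx)) (hx0 hxmem)

theorem mem_testSpace_of_contDiff {χ : ℝ → ℝ} (hc : ContDiff ℝ 1 χ) (hs : HasCompactSupport χ)
    (hS : tsupport χ ⊆ S) : χ ∈ testSpace S := by
  obtain ⟨R, hR⟩ := hs.isBounded.subset_closedBall 0
  exact ⟨⟨memHHalf_of_contDiff hc hs, ae_of_all _ fun x hx =>
    image_eq_zero_of_notMem_tsupport fun h => hx (hS h)⟩, R, ae_of_all _ fun x hx =>
    image_eq_zero_of_notMem_tsupport fun h => hx.not_ge (by simpa using hR h)⟩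

theorem GrowthBound.locallyIntegrableOn_potential_deriv (hG : GrowthBound G c α) {u : ℝ → ℝ}
    (hu : MemHHalf u) (hGu : LogAdmissible (volume.restrict S) fun x => G (u x))
    (hS : IsOpen S) :
    LocallyIntegrableOn (fun x => logPotential S G u x * deriv G (u x)) S volume := by
  rw [locallyIntegrableOn_iff hS.isLocallyClosed]
  intro k hkS hk
  obtain ⟨R, hR⟩ := hk.isBounded.subset_closedBall 0
  have hderiv : LogAdmissible (volume.restrict S) (k.indicator fun x => deriv G (u x)) := by
    refine hu.logAdmissible_of_le_exp (C := c) (β := α) (R := R) hG.exponent_nonneg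
      ((hG.continuous_deriv.comp_aestronglyMeasurable hu.1.aestronglyMeasurable).indicator
        hk.measurableSet).restrict (fun x => ?_)
      (ae_of_all _ fun x hx => indicator_of_notMem (fun h => hx.not_ge (by simpa using hR h)) _)
    exact (norm_indicator_le_norm_self (fun x => deriv G (u x)) x).trans (hG.abs_deriv_le (u x))
  refine ((hGu.integrable_potential_mul hderiv).mono_set hkS).congr_fun (fun x hx => ?_)
    hk.measurableSet
  simp only [indicator_of_mem hx]
  rfl

theorem GrowthBound.ae_potential_deriv_eq_zero (hG : GrowthBound G c α) {u : ℝ → ℝ}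
    (hu : MemHHalf u) (hGu : LogAdmissible (volume.restrict S) fun x => G (u x)) (hS : IsOpen S)
    (h0 : ∀ φ : testSpace S, energyDeriv S G u φ.1 = 0) :
    ∀ᵐ x ∂volume.restrict S, logPotential S G u x * deriv G (u x) = 0 := by
  rw [ae_restrict_iff' hS.measurableSet]
  refine hS.ae_eq_zero_of_integral_contDiff_smul_eq_zero
    (hG.locallyIntegrableOn_potential_deriv hu hGu hS) fun χ hχ hs hsub => ?_
  have hderiv := h0 ⟨χ, mem_testSpace_of_contDiff (hχ.of_le (by norm_cast)) hs hsub⟩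
  rw [hG.energyDeriv_eq_integral hu hGu] at hderiv
  rw [← hderiv, ← setIntegral_eq_integral_of_forall_compl_eq_zero fun x hx => by
    rw [image_eq_zero_of_notMem_tsupport fun h => hx (hsub h), zero_smul]]
  simp only [smul_eq_mul, mul_comm]

/-- `u` maximizes the energy on `S` among the elements `v` of `H₀^{1/2}(S)` with `B v v ≤ 1`. -/
structure IsConstrainedMax (B : LinearMap.BilinForm ℝ hHalf) (S : Set ℝ) (G : ℝ → ℝ)
    (u : hHalf) : Prop where
  vanish : ∀ᵐ x : ℝ, x ∉ S → u.1 x = 0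
  le_one : B u u ≤ 1
  energy_le : ∀ v : hHalf, (∀ᵐ x : ℝ, x ∉ S → v.1 x = 0) → B v v ≤ 1 →
    energy S G v.1 ≤ energy S G u.1

namespace IsConstrainedMax

variable {B : LinearMap.BilinForm ℝ hHalf} {u : hHalf}

theorem not_eventually_energy_lt (h : IsConstrainedMax B S G u) {φ ψ : testSpace S}
    (hadm : ∀ᶠ t in 𝓝[>] (0 : ℝ), B (u + curve (testInclusion S φ) (testInclusion S ψ) t)
      (u + curve (testInclusion S φ) (testInclusion S ψ) t) ≤ 1) :
    ¬ ∀ᶠ t in 𝓝[>] (0 : ℝ), energy S G u.1 < energy S G (u.1 + (curve φ ψ t).1) := by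
  intro hlt
  obtain ⟨t, ht, hadm⟩ := (hlt.and hadm).exists
  rw [← map_curve] at hadm
  refine ht.not_ge (h.energy_le _ ?_ hadm)
  filter_upwards [h.vanish, (curve φ ψ t).2.1.2] with x hu hφ hx
  exact (congrArg₂ (· + ·) (hu hx) (hφ hx)).trans (add_zero 0)

theorem energyDeriv_eq_zero_of_lt_one (h : IsConstrainedMax B S G u) (hB : B.IsSymm)
    (hG : GrowthBound G c α) (h0 : ∀ t, 0 ≤ G t)
    (hGu : LogAdmissible (volume.restrict S) fun x => G (u.1 x)) (hu : B u u < 1)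
    (φ : testSpace S) : energyDeriv S G u.1 φ.1 = 0 := by
  have hle (φ : testSpace S) : energyDeriv S G u.1 φ.1 ≤ 0 := le_of_not_gt fun hpos =>
    h.not_eventually_energy_lt (eventually_bilinForm_le_one_of_lt_one hB hu _ _)
      (hG.eventually_energy_lt_of_energyDeriv_pos h0 u.2 hGu hpos 0)
  have hneg := (hG.isLinearMap_energyDeriv u.2 hGu).map_neg φ
  exact le_antisymm (hle φ) (neg_nonpos.1 (hneg ▸ hle (-φ)))

theorem energyDeriv_nonpos_of_neg (h : IsConstrainedMax B S G u) (hB : B.IsSymm)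
    (hG : GrowthBound G c α) (h0 : ∀ t, 0 ≤ G t)
    (hGu : LogAdmissible (volume.restrict S) fun x => G (u.1 x)) {φ : testSpace S}
    (hφ : B u (testInclusion S φ) < 0) : energyDeriv S G u.1 φ.1 ≤ 0 := by
  obtain ⟨a, ha⟩ := exists_smul_bilinForm_lt hφ (testInclusion S φ)
  rw [← map_smul] at ha
  exact le_of_not_gt fun hpos =>
    h.not_eventually_energy_lt (eventually_bilinForm_le_one_of_neg hB h.le_one hφ.le ha)
      (hG.eventually_energy_lt_of_energyDeriv_pos h0 u.2 hGu hpos _)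

theorem exists_energyDeriv_ne_zero (h : IsConstrainedMax B S G u) (hB : B.IsSymm)
    (hG : GrowthBound G c α) (hA : CondA G) (hS : IsOpen S)
    (hGu : LogAdmissible (volume.restrict S) fun x => G (u.1 x)) (hne : ¬ u.1 =ᵐ[volume] 0)
    {φ₀ : testSpace S} (hφ₀ : B u (testInclusion S φ₀) < 0) :
    ∃ φ : testSpace S, energyDeriv S G u.1 φ.1 ≠ 0 := by
  by_contra! hzero
  obtain ⟨φ, hφcrit, hφpos⟩ := hG.exists_logForm_pos hA ⟨u.2, h.vanish⟩ hS.measurableSet hne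
  wlog hφ : B u (testInclusion S φ) ≤ 0 generalizing φ
  · refine this (-φ) (fun x hx => neg_eq_zero.2 (hφcrit x hx)) ?_
      (by rw [map_neg, map_neg]; exact neg_nonpos.2 (le_of_not_ge hφ))
    simpa [logForm] using hφpos
  obtain ⟨a, ha⟩ := exists_smul_bilinForm_lt hφ₀ (testInclusion S φ)
  rw [← map_smul] at ha
  refine h.not_eventually_energy_lt (eventually_bilinForm_le_one_of_neg hB h.le_one hφ ha)
    (hG.eventually_energy_lt_of_potential_mul_eq_zero hA.nonneg u.2 hGu ?_ hφpos (hzero _))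
  filter_upwards [hG.ae_potential_deriv_eq_zero u.2 hGu hS hzero] with x hx
  rcases mul_eq_zero.1 hx with hV | hg
  · rw [hV, zero_mul]
  · rw [hφcrit x hg, mul_zero]

theorem exists_multiplier (h : IsConstrainedMax B S G u) (hB : B.IsSymm)
    (hG : GrowthBound G c α) (hA : CondA G) (hS : IsOpen S)
    (hGu : LogAdmissible (volume.restrict S) fun x => G (u.1 x)) (hne : ¬ u.1 =ᵐ[volume] 0)
    {φ₀ : testSpace S} (hφ₀ : B u (testInclusion S φ₀) ≠ 0) :
    ∃ θ : ℝ, 0 < θ ∧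
      ∀ φ : testSpace S, B u (testInclusion S φ) = θ * energyDeriv S G u.1 φ.1 := by
  let q : testSpace S →ₗ[ℝ] ℝ := B u ∘ₗ testInclusion S
  let L : testSpace S →ₗ[ℝ] ℝ := (hG.isLinearMap_energyDeriv u.2 hGu).mk'
  have hq : q ≠ 0 := fun h0 => hφ₀ (LinearMap.congr_fun h0 φ₀)
  obtain ⟨φ₁, hφ₁⟩ := LinearMap.surjective hq (-1)
  obtain ⟨φ₂, hφ₂⟩ := h.exists_energyDeriv_ne_zero hB hG hA hS hGu hne
    (φ₀ := φ₁) (hφ₁.trans_lt neg_one_lt_zero)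
  have hL : L ≠ 0 := fun h0 => hφ₂ (LinearMap.congr_fun h0 φ₂)
  obtain ⟨θ, hθ, hqL⟩ := exists_pos_smul_eq_of_neg_imp_nonpos hq hL fun φ hφ =>
    h.energyDeriv_nonpos_of_neg hB hG hA.nonneg hGu hφ
  exact ⟨θ, hθ, LinearMap.congr_fun hqL⟩

end IsConstrainedMax

end Multiplier

/-! ### The constraints -/

/-- The embedding of `H^{1/2}(ℝ)` into `L²(ℝ)`. -/
def hHalfToLp : hHalf →ₗ[ℝ] Lp ℝ 2 (volume : Measure ℝ) where
  toFun u := u.2.memLp.toLp u.1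
  map_add' u v := MemLp.toLp_add u.2.memLp v.2.memLp
  map_smul' c u := MemLp.toLp_const_smul c u.2.memLp

/-- The bilinear form `∫_D (-Δ)^{1/4}v (-Δ)^{1/4}w + κ ∫ v w`, which defines the constraints
`halfForm 0 D u u ≤ 1` of `E_D` and `halfForm 1 ℝ u u ≤ 1` of `E_∞`. -/
def halfForm (κ : ℝ) (D : Set ℝ) : LinearMap.BilinForm ℝ hHalf :=
  let laplacianOn : hHalf →ₗ[ℝ] Lp ℝ 2 (volume.restrict D) :=
    (LpToLpRestrictCLM ℝ ℝ ℝ volume 2 D).toLinearMap ∘ₗ hHalfLaplacian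
  (innerₗ (Lp ℝ 2 (volume.restrict D))).compl₁₂ laplacianOn laplacianOn
    + κ • (innerₗ (Lp ℝ 2 (volume : Measure ℝ))).compl₁₂ hHalfToLp hHalfToLp

theorem halfForm_apply (κ : ℝ) (D : Set ℝ) (v w : hHalf) :
    halfForm κ D v w
      = (∫ x in D, quarterLaplacian v.1 x * quarterLaplacian w.1 x) + κ * ∫ x, v.1 x * w.1 x := by
  have hlap (z : hHalf) : LpToLpRestrictCLM ℝ ℝ ℝ volume 2 D (hHalfLaplacian z)
      =ᵐ[volume.restrict D] quarterLaplacian z.1 :=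
    (LpToLpRestrictCLM_coeFn ℝ D _).trans
      (ae_restrict_of_ae (quarterLaplacian_ae_eq z).symm)
  simp only [halfForm, LinearMap.add_apply, LinearMap.smul_apply, LinearMap.compl₁₂_apply,
    innerₗ_apply_apply, L2.inner_def, smul_eq_mul]
  refine congrArg₂ (· + ·) ?_ (congrArg (κ * ·) ?_)
  · refine integral_congr_ae ?_
    filter_upwards [hlap v, hlap w] with x hv hw
    simp [hv, hw, mul_comm]
  · refine integral_congr_ae ?_
    filter_upwards [v.2.memLp.coeFn_toLp, w.2.memLp.coeFn_toLp] with x hv hw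
    simp [hHalfToLp, hv, hw, mul_comm]

theorem isSymm_halfForm (κ : ℝ) (D : Set ℝ) : (halfForm κ D).IsSymm :=
  ⟨fun v w => by simp only [halfForm_apply, mul_comm]⟩

theorem halfForm_eq_zero_of_ae (κ : ℝ) (D : Set ℝ) {u : hHalf} (h : u.1 =ᵐ[volume] 0)
    (v : hHalf) : halfForm κ D u v = 0 := by
  have hlap : quarterLaplacian u.1 =ᵐ[volume] 0 := by
    rw [quarterLaplacian_congr h]
    refine (quarterLaplacian_ae_eq 0).trans ?_
    rw [map_zero]
    exact Lp.coeFn_zero _ _ _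
  rw [halfForm_apply, integral_eq_zero_of_ae, integral_eq_zero_of_ae, mul_zero, add_zero]
  · filter_upwards [h] with x hx
    exact mul_eq_zero_of_left hx _
  · filter_upwards [ae_restrict_of_ae hlap] with x hx
    exact mul_eq_zero_of_left hx _

theorem eLpNorm_two_sq_eq_ofReal {μ : Measure ℝ} {f : ℝ → ℝ} (hf : MemLp f 2 μ) :
    eLpNorm f 2 μ ^ 2 = ENNReal.ofReal (∫ x, f x * f x ∂μ) := by
  have hint : Integrable (fun x => f x * f x) μ := hf.integrable_mul hf
  rw [eLpNorm_two_sq, ofReal_integral_eq_lintegral_ofReal hint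
    (ae_of_all _ fun x => mul_self_nonneg (f x))]
  refine lintegral_congr fun x => ?_
  rw [Real.enorm_eq_ofReal_abs, ← ENNReal.ofReal_pow (abs_nonneg _), sq_abs, sq]

theorem mem_unitSet_iff {I D : Set ℝ} {w : hHalf} :
    w.1 ∈ unitSet I D ↔ (∀ᵐ x : ℝ, x ∉ I → w.1 x = 0) ∧ halfForm 0 D w w ≤ 1 := by
  have h : eLpNorm (quarterLaplacian w.1) 2 (volume.restrict D) ≤ 1 ↔ halfForm 0 D w w ≤ 1 := by
    rw [← pow_le_one_iff two_ne_zero,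
      eLpNorm_two_sq_eq_ofReal ((memLp_quarterLaplacian w.1).restrict D), ENNReal.ofReal_le_one,
      halfForm_apply, zero_mul, add_zero]
  exact (and_congr_left' (and_iff_right w.2)).trans (and_congr_right' h)

theorem mem_unitSetInfty_iff {w : hHalf} : w.1 ∈ unitSetInfty ↔ halfForm 1 univ w w ≤ 1 := by
  refine (and_iff_right w.2).trans ?_
  rw [normHHalf, ← ENNReal.le_rpow_inv_iff (by norm_num), ENNReal.one_rpow,
    eLpNorm_two_sq_eq_ofReal (memLp_quarterLaplacian w.1), eLpNorm_two_sq_eq_ofReal w.2.memLp,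
    ← ENNReal.ofReal_add (integral_nonneg fun x => mul_self_nonneg _)
      (integral_nonneg fun x => mul_self_nonneg _), ENNReal.ofReal_le_one, halfForm_apply, one_mul,
    Measure.restrict_univ]

/-! ### Admissibility of the maximizers -/

theorem CondA.logAdmissible_of_isBounded {G : ℝ → ℝ} (hA : CondA G) {u : ℝ → ℝ} (hu : MemHHalf u)
    {I : Set ℝ} (hI : MeasurableSet I) (hb : Bornology.IsBounded I) :
    LogAdmissible (volume.restrict I) fun x => G (u x) := by
  obtain ⟨α, hα, c, -, hle⟩ := hA.growth
  obtain ⟨R, hR⟩ := hb.subset_closedBall 0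
  refine hu.logAdmissible_of_le_exp (C := c) (β := α) (R := R) hα.le
    (hA.continuous.comp_aestronglyMeasurable hu.memLp.aestronglyMeasurable).restrict
    (fun x => by rw [abs_of_nonneg (hA.nonneg _)]; exact hle _) ?_
  filter_upwards [ae_restrict_mem hI] with x hx hxR
  exact absurd hxR (by simpa using hR hx)

theorem logWeight_le_mul_posLog_sub {x y : ℝ} (h : 3 ≤ |x - y|) :
    logWeight y ≤ (3 + log⁺ x) * log⁺ (x - y) := by
  have hlog : 1 ≤ log⁺ (x - y) := by
    rw [Real.posLog_eq_log (by linarith), ← Real.log_abs, Real.le_log_iff_exp_le (by linarith)]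
    linarith [Real.exp_one_lt_d9]
  have hadd := Real.posLog_add (x := x) (y := -(x - y))
  have hx : 0 ≤ log⁺ x := Real.posLog_nonneg
  rw [Real.posLog_neg, neg_sub, add_sub_cancel] at hadd
  unfold logWeight
  nlinarith [Real.log_two_lt_d9]

theorem LogAdmissible.of_integrable_posLog {F : ℝ → ℝ} (hF : MemLp F 2 volume) {x : ℝ}
    (h : Integrable fun y => log⁺ (x - y) * F y) : LogAdmissible volume F := by
  have hnear : LogAdmissible volume ((Metric.ball x 3).indicator F) := by
    refine .of_bounded_support le_rfl (R := |x| + 3) (hF.indicator Metric.isOpen_ball.measurableSet)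
      (ae_of_all _ fun y hy => indicator_of_notMem (fun hyx => ?_) F)
    rw [Metric.mem_ball, Real.dist_eq] at hyx
    linarith [abs_sub_abs_le_abs_sub y x]
  refine ⟨hF, ((h.norm.const_mul (3 + log⁺ x)).add hnear.integrable.norm).mono'
    (continuous_logWeight.aestronglyMeasurable.mul hF.aestronglyMeasurable)
    (ae_of_all _ fun y => ?_)⟩
  have hx : 0 ≤ log⁺ x := Real.posLog_nonneg
  have hlog : 0 ≤ log⁺ (x - y) := Real.posLog_nonneg
  simp only [Pi.add_apply, norm_mul, Real.norm_of_nonneg hlog,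
    Real.norm_of_nonneg (logWeight_pos y).le]
  by_cases hy : y ∈ Metric.ball x 3
  · rw [indicator_of_mem hy]
    exact le_add_of_nonneg_left (by positivity)
  · rw [indicator_of_notMem hy, norm_zero, mul_zero, add_zero, ← mul_assoc]
    refine mul_le_mul_of_nonneg_right (logWeight_le_mul_posLog_sub ?_) (norm_nonneg _)
    rwa [Metric.mem_ball, not_lt, dist_comm, Real.dist_eq] at hy

namespace CondA1

variable {G u : ℝ → ℝ}

theorem map_zero (hA : CondA1 G) : G 0 = 0 := by
  obtain ⟨C, hC⟩ := hA.isBigO.bound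
  simpa using hC.self_of_nhds

theorem memLp (hA : CondA1 G) (hu : MemHHalf u) : MemLp (fun x => G (u x)) 2 volume := by
  obtain ⟨α, hα, c, -, hlarge⟩ := hA.growth
  obtain ⟨C, hC⟩ := hA.isBigO.bound
  obtain ⟨δ, hδ, hsmall⟩ := Metric.eventually_nhds_iff.1 hC
  have hs : NullMeasurableSet {x | δ ≤ |u x|}ᶜ volume :=
    (nullMeasurableSet_le aemeasurable_const hu.memLp.1.aemeasurable.norm).compl
  rw [memLp_two_iff (hA.continuous.comp_aestronglyMeasurable hu.memLp.aestronglyMeasurable),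
    ← setLIntegral_univ, ← union_compl_self {x | δ ≤ |u x|}]
  refine (lintegral_union_le _ _ _).trans_lt (ENNReal.add_lt_top.2 ⟨?_, ?_⟩)
  · have hexp : ∫⁻ x in {x | δ ≤ |u x|},
        ENNReal.ofReal (c ^ 2) * ENNReal.ofReal (Real.exp (2 * α * u x ^ 2)) < ∞ := by
      rw [lintegral_const_mul' _ _ ENNReal.ofReal_ne_top]
      exact ENNReal.mul_lt_top ENNReal.ofReal_lt_top
        (hu.setLIntegral_le_abs_exp_lt_top (by positivity) hδ)
    refine (lintegral_mono fun x => ?_).trans_lt hexp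
    rw [← ofReal_norm, ← ENNReal.ofReal_pow (norm_nonneg _),
      Real.norm_of_nonneg (hA.nonneg _), ← ENNReal.ofReal_mul (by positivity)]
    refine ENNReal.ofReal_le_ofReal ((pow_le_pow_left₀ (hA.nonneg _) (hlarge _) 2).trans_eq ?_)
    rw [mul_pow, ← Real.exp_nat_mul, Nat.cast_ofNat, mul_assoc]
  · have hlin : MemLp (fun x => C * |u x|) 2 (volume.restrict {x | δ ≤ |u x|}ᶜ) :=
      (hu.memLp.norm.const_mul C).restrict _
    refine (lintegral_mono_ae ?_).trans_lt ((memLp_two_iff hlin.1).1 hlin)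
    filter_upwards [ae_restrict_mem₀ hs] with x hx
    have hle := hsmall (y := u x) (by simpa [Real.dist_eq] using hx)
    rw [Real.norm_eq_abs |u x|, abs_abs] at hle
    gcongr
    exact enorm_le_iff_norm_le.2 (hle.trans (le_abs_self _))

theorem exists_integrable_posLog (hA : CondA1 G) (hu : MemHHalf u)
    (hfin : energyNeg univ G u ≠ ∞) (hne : ¬ (fun x => G (u x)) =ᵐ[volume] 0) :
    ∃ x, Integrable fun y => log⁺ (x - y) * G (u y) := by
  have hGu : AEStronglyMeasurable (fun x => G (u x)) volume := (hA.memLp hu).1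
  have hk : Measurable fun p : ℝ × ℝ => log⁺ |p.1 - p.2| :=
    Real.continuous_posLog.measurable.comp (by fun_prop)
  have hm : AEMeasurable (fun p : ℝ × ℝ =>
      ENNReal.ofReal (log⁺ |p.1 - p.2| * G (u p.1) * G (u p.2))) (volume.prod volume) :=
    ((hk.aemeasurable.mul hGu.aemeasurable.comp_fst).mul hGu.aemeasurable.comp_snd).ennreal_ofReal
  rw [energyNeg, Measure.restrict_univ] at hfin
  have hfreq : ∃ᵐ x ∂volume, G (u x) ≠ 0 := fun h => hne (h.mono fun x => not_not.1)
  obtain ⟨x, hx, hlt⟩ := (hfreq.and_eventually (ae_lt_top' hm.lintegral_prod_right' hfin)).exists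
  have hint : Integrable fun y => log⁺ |x - y| * G (u x) * G (u y) := by
    refine ⟨((hk.comp measurable_prodMk_left).mul_const _).aestronglyMeasurable.mul hGu, ?_⟩
    rwa [hasFiniteIntegral_iff_ofReal (ae_of_all _ fun y =>
      mul_nonneg (mul_nonneg Real.posLog_nonneg (hA.nonneg _)) (hA.nonneg _))]
  refine ⟨x, (hint.const_mul (G (u x))⁻¹).congr (ae_of_all _ fun y => ?_)⟩
  simp only [Real.posLog_abs]
  field_simp

theorem logAdmissible (hA : CondA1 G) (hu : MemHHalf u) (hfin : energyNeg univ G u ≠ ∞) :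
    LogAdmissible volume fun x => G (u x) := by
  by_cases hzero : (fun x => G (u x)) =ᵐ[volume] 0
  · exact .of_integrable_posLog (hA.memLp hu) (x := 0) <| (integrable_zero _ _ _).congr <| by
      filter_upwards [hzero] with y hy
      exact (mul_eq_zero_of_right _ hy).symm
  · obtain ⟨x, hx⟩ := hA.exists_integrable_posLog hu hfin hzero
    exact .of_integrable_posLog (hA.memLp hu) hx

theorem energyNeg_ne_top (hA : CondA1 G) (hmax : IsMaxOn (energy univ G) unitSetInfty u) :
    energyNeg univ G u ≠ ∞ := by
  intro htop
  have hle : energy univ G (0 : hHalf).1 ≤ energy univ G u :=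
    hmax (mem_unitSetInfty_iff.2 (by simp))
  have hzero : energy univ G (0 : hHalf).1 = 0 := by
    simp [energy, energyPos, energyNeg, hA.map_zero]
  rw [hzero, energy, htop, EReal.coe_ennreal_top, EReal.sub_top] at hle
  simp at hle

end CondA1

/-! ### The Euler–Lagrange equations -/

theorem MemHHalfZero.mem_testSpace {I : Set ℝ} (hb : Bornology.IsBounded I) {φ : ℝ → ℝ}
    (hφ : MemHHalfZero I φ) : φ ∈ testSpace I := by
  obtain ⟨R, hR⟩ := hb.subset_closedBall 0
  refine ⟨hφ, R, ?_⟩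
  filter_upwards [hφ.2] with x hx hxR
  exact hx fun h => hxR.not_ge (by simpa using hR h)

theorem exists_weakSolution {G : ℝ → ℝ} {c α : ℝ} (hG : GrowthBound G c α) (hA : CondA G)
    {I : Set ℝ} (hI : IsOpen I) (hb : Bornology.IsBounded I) {D : Set ℝ} {u : ℝ → ℝ}
    (hu : u ∈ unitSet I D) (hmax : IsMaxOn (energy I G) (unitSet I D) u) :
    ∃ θ : ℝ, 0 < θ ∧ WeakSolution I D G θ u := by
  obtain ⟨u, rfl⟩ : ∃ v : hHalf, v.1 = u := ⟨⟨u, hu.1.1⟩, rfl⟩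
  have hB := isSymm_halfForm 0 D
  have hGu := hA.logAdmissible_of_isBounded u.2 hI.measurableSet hb
  have hcm : IsConstrainedMax (halfForm 0 D) I G u :=
    ⟨(mem_unitSet_iff.1 hu).1, (mem_unitSet_iff.1 hu).2, fun v hv hv1 =>
      hmax (mem_unitSet_iff.2 ⟨hv, hv1⟩)⟩
  obtain ⟨θ, hθ, heq⟩ : ∃ θ : ℝ, 0 < θ ∧ ∀ φ : testSpace I,
      halfForm 0 D u (testInclusion I φ) = θ * energyDeriv I G u.1 φ.1 := by
    by_cases hq : ∃ φ₀ : testSpace I, halfForm 0 D u (testInclusion I φ₀) ≠ 0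
    · obtain ⟨φ₀, hφ₀⟩ := hq
      exact hcm.exists_multiplier hB hG hA hI hGu
        (fun h0 => hφ₀ (halfForm_eq_zero_of_ae 0 D h0 _)) hφ₀
    · push Not at hq
      have hlt : halfForm 0 D u u < 1 := (hq ⟨u.1, hu.1.mem_testSpace hb⟩).trans_lt one_pos
      exact ⟨1, one_pos, fun φ => by
        rw [hq, hcm.energyDeriv_eq_zero_of_lt_one hB hG hA.nonneg hGu hlt, mul_zero]⟩
  refine ⟨θ, hθ, hGu.potentialDefined, fun φ hφ => ?_⟩
  have hφ' := heq ⟨φ, hφ.mem_testSpace hb⟩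
  rw [hG.energyDeriv_eq_integral u.2 hGu, halfForm_apply, zero_mul, add_zero] at hφ'
  exact ⟨hG.integrable_potential_deriv u.2 hGu ⟨φ, hφ.mem_testSpace hb⟩, hφ'⟩

theorem exists_weakSolutionInfty {G : ℝ → ℝ} {c α : ℝ} (hG : GrowthBound G c α) (hA : CondA1 G)
    {u : ℝ → ℝ} (hu : u ∈ unitSetInfty) (hmax : IsMaxOn (energy univ G) unitSetInfty u) :
    ∃ θ : ℝ, WeakSolutionInfty G θ u := by
  obtain ⟨u, rfl⟩ : ∃ v : hHalf, v.1 = u := ⟨⟨u, hu.1⟩, rfl⟩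
  have hGu : LogAdmissible (volume.restrict univ) fun x => G (u.1 x) := by
    rw [Measure.restrict_univ]
    exact hA.logAdmissible u.2 (hA.energyNeg_ne_top hmax)
  have hcm : IsConstrainedMax (halfForm 1 univ) univ G u :=
    ⟨ae_of_all _ fun x hx => absurd (mem_univ x) hx, mem_unitSetInfty_iff.1 hu, fun v _ hv =>
      hmax (mem_unitSetInfty_iff.2 hv)⟩
  obtain ⟨θ, heq⟩ : ∃ θ : ℝ, ∀ φ : testSpace univ,
      halfForm 1 univ u (testInclusion univ φ) = θ * energyDeriv univ G u.1 φ.1 := by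
    by_cases hq : ∃ φ₀ : testSpace univ, halfForm 1 univ u (testInclusion univ φ₀) ≠ 0
    · obtain ⟨φ₀, hφ₀⟩ := hq
      obtain ⟨θ, -, heq⟩ := hcm.exists_multiplier (isSymm_halfForm 1 univ) hG hA.toCondA
        isOpen_univ hGu (fun h0 => hφ₀ (halfForm_eq_zero_of_ae 1 univ h0 _)) hφ₀
      exact ⟨θ, heq⟩
    · push Not at hq
      exact ⟨0, fun φ => by rw [hq, zero_mul]⟩
  refine ⟨θ, hGu.potentialDefined, fun φ hφ hb => ?_⟩
  have hmem : φ ∈ testSpace univ := ⟨⟨hφ, ae_of_all _ fun x hx => absurd (mem_univ x) hx⟩, hb⟩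
  refine ⟨integrableOn_univ.1 (hG.integrable_potential_deriv u.2 hGu ⟨φ, hmem⟩), ?_⟩
  have hφ' := heq ⟨φ, hmem⟩
  rw [hG.energyDeriv_eq_integral u.2 hGu, halfForm_apply, one_mul, Measure.restrict_univ] at hφ'
  exact (integral_add ((memLp_quarterLaplacian u.1).integrable_mul (memLp_quarterLaplacian φ))
    (u.2.memLp.integrable_mul hφ.memLp)).trans hφ'

end

end LogTM

theorem proposition1p5_general (G : ℝ → ℝ) {c α : ℝ} (hG : ContDiff ℝ 1 G) (hA : LogTM.CondA G)
    (hα : 0 ≤ α) (hg : ∀ t : ℝ, deriv G t ≤ c * Real.exp (α * t ^ 2)) :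
    (∀ I : Set ℝ, IsOpen I → Bornology.IsBounded I → ∀ D : Set ℝ, ∀ u ∈ LogTM.unitSet I D,
      IsMaxOn (LogTM.energy I G) (LogTM.unitSet I D) u →
      ∃ θ : ℝ, 0 < θ ∧ LogTM.WeakSolution I D G θ u) ∧
    (LogTM.CondA1 G →
      ∀ u ∈ LogTM.unitSetInfty,
        IsMaxOn (LogTM.energy Set.univ G) LogTM.unitSetInfty u →
        ∃ θ : ℝ, LogTM.WeakSolutionInfty G θ u) :=
  have hgrowth := hA.growthBound hG hα hg
  ⟨fun _ hI hb _ _ hu hmax => LogTM.exists_weakSolution hgrowth hA hI hb hu hmax,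
    fun hA1 _ hu hmax => LogTM.exists_weakSolutionInfty hgrowth hA1 hu hmax⟩

theorem proposition1p5 (G : ℝ → ℝ) (hG : ContDiff ℝ 1 G) (hA : LogTM.CondA G)
    (hg : ∃ c > 0, ∃ α > 0, ∀ t : ℝ, deriv G t ≤ c * Real.exp (α * t ^ 2)) :
    (∀ a b : ℝ, a < b → ∀ D : Set ℝ, (D = Set.Ioo a b ∨ D = Set.univ) →
      ∀ u ∈ LogTM.unitSet (Set.Ioo a b) D,
        IsMaxOn (LogTM.energy (Set.Ioo a b) G) (LogTM.unitSet (Set.Ioo a b) D) u →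
        ∃ θ : ℝ, 0 < θ ∧ LogTM.WeakSolution (Set.Ioo a b) D G θ u) ∧
    (LogTM.CondA1 G →
      ∀ u ∈ LogTM.unitSetInfty,
        IsMaxOn (LogTM.energy Set.univ G) LogTM.unitSetInfty u →
        ∃ θ : ℝ, LogTM.WeakSolutionInfty G θ u) := by
  obtain ⟨c, -, α, hα, hg⟩ := hg
  obtain ⟨hI, hInfty⟩ := proposition1p5_general G hG hA hα.le hg
  exact ⟨fun a b _ D _ => hI _ isOpen_Ioo (Metric.isBounded_Ioo a b) D, hInfty⟩
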